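/- Consider a data shuffling system with a master node, $K$ worker nodes and $N=K$ files, each file a string of $B$ bits; sizes are measured in files (one unit is $B$ bits), and $B\ge 1$ may be chosen freely. At iteration $t$ worker $i$ processes file $i$. In an uncoded placement with cache size $S$, every worker $i$ caches all of file $i$ and arbitrary subsets of the bits of the other files, in total at most $S$ files; the placement is chosen before the next assignment is known. An assignment is a permutation $d$ of $[K]$: worker $i$ has to process file $d(i)$ at iteration $t+1$. The master, which knows all files, broadcasts one message to all workers, from which, together with its own cache content, every worker $i$ must recover file $d(i)$. The delivery load of a placement for $d$ is the least possible size of such a message. The file transition graph of $d$ is the directed graph on the workers with an edge from $i$ to $\ell$ when $d(\ell)=i$; it consists of directed cycles (self-loops included). For a file transition graph $\mathcal G$, the optimal delivery load $R^\star(\mathcal G,S)$ is the infimum, over all $B$ and all uncoded placements with cache size $S$, of the delivery load averaged over all assignments whose file transition graph is isomorphic to $\mathcal G$. Binomial coefficients $\binom nk$ with $n<k$ are $0$. Let $\mathcal G$ be the file transition graph of an assignment and let $\gamma$ be its number of cycles. Then: 1. For every integer $S$ with $1\le S\le K$, $$R^\star(\mathcal G,S)=\frac{\binom{K-1}{S}-\binom{\gamma-1}{S}}{\binom{K-1}{S-1}}.$$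 Moreover, for each such $S$ there is a single uncoded placement (for a suitable $B$) whose delivery load for every assignment $d$ equals this value, with $\gamma$ the number of cycles of the file transition graph of $d$. 2. For every real $S$ with $1\le S\le K$ (in particular for non-integer $S$), $R^\star(\mathcal G,S)$ is the value at $S$ of the lower convex envelope of the $K$ corner points $\left(s,\ \frac{\binom{K-1}{s}-\binom{\gamma-1}{s}}{\binom{K-1}{s-1}}\right)$, $s=1,\dots,K$. Moreover, for every $\varepsilon>0$ there is a single uncoded placement with cache size $S$ whose delivery load for every assignment exceeds the corresponding envelope value by at most $\varepsilon$. 3. For every integer $S$ with $1\le S\le K$: if $\gamma-1<S$, then $R^\star(\mathcal G,S)=\binom{K-1}{S}/\binom{K-1}{S-1}$; this is the maximum of $R^\star(\mathcal G,S)$ over all file transition graphs $\mathcal G$ on $K$ workers; and the optimal worst-case delivery load, that is, the infimum over all $B$ and all uncoded placements with cache size $S$ of the maximum delivery load over all assignments, is $$R^\star_{\text{worst-case}}=\frac{\binom{K-1}{S}}{\binom{K-1}{S-1}}.$$ -/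

import Mathlib

namespace DataShuffling

/-- The realization of the `K` files, each a string of `B` bits (one unit of size is `B` bits). -/
abbrev Files (K B : ℕ) : Type := Fin K → Fin B → Bool

/-- An uncoded placement with cache size `S` (in units of one file) in the canonical setting:
`bits j f` is the set of positions of those bits of file `f` that worker `j` caches.
Worker `j` currently processes file `j`, so it holds that file completely, and the bits cached at
any worker amount to at most `S` files. -/
structure Placement (K B : ℕ) (S : ℝ) where
  bits : Fin K → Fin K → Finset (Fin B)
  processing : ∀ j, bits j j = Finset.univ
  capacity : ∀ j, ((∑ f, (bits j f).card : ℕ) : ℝ) ≤ S * B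

variable {K B : ℕ} {S : ℝ}

/-- The content of the cache of worker `j`: the values of all the bits that it caches. -/
def Placement.content (Z : Placement K B S) (j : Fin K) (W : Files K B) :
    (f : Fin K) → {b : Fin B // b ∈ Z.bits j f} → Bool :=
  fun f b => W f b.1

/-- The assignment `d` (worker `i` has to process file `d i` next) can be served by broadcasting a
message of `l` bits: there are an encoder, which sees all the files, and for each worker a decoder,
which sees only the message and the cache content of this worker, such that every worker always
recovers the file newly assigned to it. -/
def Placement.CanDeliver (Z : Placement K B S) (d : Equiv.Perm (Fin K)) (l : ℕ) : Prop :=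
  ∃ enc : Files K B → (Fin l → Bool),
    ∀ i : Fin K,
      ∃ dec : (Fin l → Bool) →
          ((f : Fin K) → {b : Fin B // b ∈ Z.bits i f} → Bool) → (Fin B → Bool),
        ∀ W : Files K B, dec (enc W) (Z.content i W) = W (d i)

/-- The delivery load of the placement `Z` for the assignment `d`: the least size of a broadcast
message, measured in files. -/
noncomputable def Placement.load (Z : Placement K B S) (d : Equiv.Perm (Fin K)) : ℝ :=
  (sInf {l : ℕ | Z.CanDeliver d l} : ℕ) / (B : ℝ)

/-- The file transition graph of the assignment `d`: there is an edge from worker `i` to worker `l`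
when the file that `i` processes now (file `i`) is the one assigned to `l` next. -/
def fileTransitionGraph (d : Equiv.Perm (Fin K)) : Digraph (Fin K) where
  Adj i l := d l = i

/-- The number of directed cycles (self-loops are cycles of length one) of a digraph. A directed
cycle is a nonempty cyclic sequence, up to rotation, of distinct vertices, each of which is joined
to its cyclic successor. -/
noncomputable def numCycles {V : Type*} (G : Digraph V) : ℕ :=
  Set.ncard {c : Cycle V | c ≠ Cycle.nil ∧ c.Nodup ∧ c.Chain G.Adj}

open Classical in
/-- The assignments whose file transition graph is isomorphic to `G`. -/
noncomputable def assignments (G : Digraph (Fin K)) : Finset (Equiv.Perm (Fin K)) :=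
  Finset.univ.filter fun d => Nonempty ((fileTransitionGraph d).Adj ≃r G.Adj)

/-- The delivery load of the placement `Z`, averaged over all assignments whose file transition
graph is isomorphic to `G`. -/
noncomputable def Placement.avgLoad (Z : Placement K B S) (G : Digraph (Fin K)) : ℝ :=
  (∑ d ∈ assignments G, Z.load d) / (assignments G).card

/-- The delivery load of the placement `Z` in the worst case over all assignments. -/
noncomputable def Placement.maxLoad (Z : Placement K B S) : ℝ :=
  ⨆ d : Equiv.Perm (Fin K), Z.load d

/-- The optimal delivery load for the file transition graph `G` and cache size `S`. A placement is
chosen before the assignment; the file length `B` in bits is arbitrary. -/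
noncomputable def optLoad (S : ℝ) (G : Digraph (Fin K)) : ℝ :=
  sInf {r : ℝ | ∃ B : ℕ, 0 < B ∧ ∃ Z : Placement K B S, r = Z.avgLoad G}

/-- The optimal worst-case delivery load over all assignments. -/
noncomputable def optWorstLoad (K : ℕ) (S : ℝ) : ℝ :=
  sInf {r : ℝ | ∃ B : ℕ, 0 < B ∧ ∃ Z : Placement K B S, r = Z.maxLoad}

/-- `((K-1 choose s) - (γ-1 choose s)) / (K-1 choose s-1)`. -/
noncomputable def cornerLoad (K γ s : ℕ) : ℝ :=
  (((K - 1).choose s : ℝ) - ((γ - 1).choose s : ℝ)) / ((K - 1).choose (s - 1) : ℝ)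

/-- The `K` corner points `(s, cornerLoad K γ s)`, `s = 1, …, K`. -/
def cornerPoints (K γ : ℕ) : Set (ℝ × ℝ) :=
  {p | ∃ s : ℕ, 1 ≤ s ∧ s ≤ K ∧ p = ((s : ℝ), cornerLoad K γ s)}

/-- The lower convex envelope at `x` of a set of points in the plane: the lower boundary of their
convex hull. -/
noncomputable def lowerConvexEnvelope (P : Set (ℝ × ℝ)) (x : ℝ) : ℝ :=
  sInf {y : ℝ | (x, y) ∈ convexHull ℝ P}

end DataShuffling

/-! ### Cycles of the file transition graph -/

namespace DataShuffling
open Function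

/-! The identity `cornerLoad_eq_cornerSum` writes the corner load as the sum over `j < K - γ` of
`(K-s choose j+1) / (K-1 choose j+1)`, a convex function of the number `K - s` of workers that do
not cache a bit.

Converse. Omit one worker from each cycle and order the others so that no file wanted by a worker is
processed by that worker or an earlier one (`exists_acyclic_order`). The message must then be at
least as long as the total number of wanted bits that are missing from the caches of the wanting
worker and all earlier ones (`Placement.sum_card_le_of_canDeliver`). Averaged over all relabellings
of the workers, a bit cached by `t` workers contributes the corner load at `t`. Hence the average
load dominates the height of a point in the convex hull of the corners, whose abscissa, the mean of
`t`, is at most `S` (`Placement.avgLoad_ge`).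

Achievability. For integer `S = s`, label the bits of file `f` by the `s`-sets `T` containing `f`,
and let the workers in `T` cache that bit. Regard file `f` as a chain `x f` modulo two on the
simplex of workers, and form `y = ∑ i, e i ∧ (∂ x i + ∂ x (d i))`. Worker `i` can read its missing
bits off `y`. Moreover `∂ y = 0`, so the `s`-sets avoiding a fixed cycle representative `r`
determine `y`; a second family of relations, one for each set of cycles, makes the `s`-sets of
representatives redundant too. This leaves `(K-1 choose s) - (γ-1 choose s)` bits to send.
Non-integer `S` follows by splitting the files between two neighbouring integer sizes
(`exists_placement_between`). -/

theorem exists_eq_periodicOrbit {α : Type*} {f : α → α} {c : Cycle α} (hc : c ≠ Cycle.nil)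
    (hnd : c.Nodup) (hch : c.Chain fun a b => f a = b) :
    ∃ x, c = periodicOrbit f x := by
  induction c using Quotient.inductionOn' with | _ l
  cases l with
  | nil => exact absurd rfl hc
  | cons x l =>
    change Cycle.Chain _ (↑(x :: l) : Cycle α) at hch
    change Cycle.Nodup (↑(x :: l) : Cycle α) at hnd
    rw [Cycle.chain_coe_cons] at hch
    rw [Cycle.nodup_coe_iff] at hnd
    have hget : ∀ (k : ℕ) (hk : k < (x :: (l ++ [x])).length),
        (x :: (l ++ [x]))[k] = f^[k] x := by
      intro k
      induction k with
      | zero => intro _; rfl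
      | succ k ih =>
        intro hk
        have h := List.isChain_iff_getElem.1 hch k hk
        rw [iterate_succ_apply', ← ih (by omega)]
        exact h.symm
    have hget' : ∀ (k : ℕ) (hk : k < (x :: l).length), (x :: l)[k] = f^[k] x := by
      intro k hk
      rw [← hget k (by simp at hk ⊢; omega)]
      simp only [← List.cons_append]
      rw [List.getElem_append_left hk]
    have hper : IsPeriodicPt f (l.length + 1) x := by
      have h := hget (l.length + 1) (by simp)
      simp only [← List.cons_append] at h
      rw [List.getElem_append_right (by simp)] at h
      simpa [IsPeriodicPt, IsFixedPt] using h.symm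
    -- A smaller minimal period would repeat the entry at position 0, against `Nodup`.
    have hmin : minimalPeriod f x = l.length + 1 := by
      refine le_antisymm (hper.minimalPeriod_le (by omega)) ?_
      by_contra! hlt
      have h0 := hget' 0 (by simp)
      have h1 := hget' (minimalPeriod f x) (by simpa using hlt)
      rw [iterate_minimalPeriod] at h1
      have := (List.Nodup.getElem_inj_iff hnd).1 (h1.trans h0.symm)
      exact (hper.minimalPeriod_pos (by omega)).ne' this
    refine ⟨x, ?_⟩
    rw [periodicOrbit_def, hmin]
    change ((x :: l : List α) : Cycle α) = _
    congr 1
    apply List.ext_getElem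
    · simp
    · intro k hk _
      rw [hget' k hk, List.getElem_map, List.getElem_range]

variable {K : ℕ}

theorem mem_periodicPts_perm {α : Type*} [Finite α] (d : Equiv.Perm α) (x : α) :
    x ∈ periodicPts d :=
  d.injective.mem_periodicPts x

theorem numCycles_fileTransitionGraph (d : Equiv.Perm (Fin K)) :
    numCycles (fileTransitionGraph d) = (Set.range (periodicOrbit (d⁻¹ : Equiv.Perm _))).ncard := by
  unfold numCycles
  congr 1
  ext c
  constructor
  · rintro ⟨h1, h2, h3⟩
    obtain ⟨x, hx⟩ := exists_eq_periodicOrbit (f := (d⁻¹ : Equiv.Perm _)) h1 h2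
      (Cycle.Chain.imp (fun a b h => by
        change d b = a at h
        rw [← h]; simp) h3)
    exact ⟨x, hx.symm⟩
  · rintro ⟨x, rfl⟩
    refine ⟨?_, nodup_periodicOrbit, ?_⟩
    · rw [Ne, periodicOrbit_eq_nil_iff_not_periodic_pt, not_not]
      exact mem_periodicPts_perm _ _
    · rw [periodicOrbit_chain' _ (mem_periodicPts_perm _ _)]
      intro n
      change d _ = _
      rw [iterate_succ_apply']
      simp

theorem exists_cycle_representative (d : Equiv.Perm (Fin K)) :
    ∃ rep : Fin K → Fin K, (∀ x, rep (d x) = rep x) ∧ (∀ x, ∃ n : ℕ, d^[n] x = rep x) ∧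
      (∀ x, rep (rep x) = rep x) ∧
      (Finset.univ.filter fun x => rep x = x).card = numCycles (fileTransitionGraph d) := by
  classical
  set o := periodicOrbit (d⁻¹ : Equiv.Perm (Fin K)) with ho
  have hs : ∀ x, ∃ y, o y = o x := fun x => ⟨x, rfl⟩
  -- The chosen proposition depends on `x` only through `o x`, so workers in the same orbit get the
  -- same representative.
  let rep : Fin K → Fin K := fun x => (hs x).choose
  have hrep : ∀ x, o (rep x) = o x := fun x => (hs x).choose_spec
  have hcongr : ∀ x y, o x = o y → rep x = rep y := by
    intro x y h
    simp only [rep, h]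
  refine ⟨rep, fun x => hcongr _ _ ?_, fun x => ?_, fun x => hcongr _ _ (hrep x), ?_⟩
  · have := periodicOrbit_apply_eq (mem_periodicPts_perm (d⁻¹ : Equiv.Perm _) (d x))
    rw [(by simp : (d⁻¹ : Equiv.Perm _) (d x) = x)] at this
    exact this.symm
  · have h : x ∈ o (rep x) := by
      rw [hrep]; exact self_mem_periodicOrbit (mem_periodicPts_perm _ _)
    obtain ⟨n, hn⟩ := (mem_periodicOrbit_iff (mem_periodicPts_perm _ _)).1 h
    have hl : LeftInverse d (d⁻¹ : Equiv.Perm _) := fun y => by simp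
    have h' := hl.iterate n (rep x)
    rw [hn] at h'
    exact ⟨n, h'⟩
  · rw [numCycles_fileTransitionGraph, ← Set.ncard_coe_finset]
    have himg : Set.range o = o '' {x | rep x = x} := by
      ext c
      constructor
      · rintro ⟨x, rfl⟩
        exact ⟨rep x, hcongr _ _ (hrep x), hrep x⟩
      · rintro ⟨x, -, rfl⟩
        exact ⟨x, rfl⟩
    rw [himg, Set.InjOn.ncard_image]
    · simp
    · intro x hx y hy h
      rw [← hx, ← hy]
      exact hcongr _ _ h

theorem numCycles_pos [NeZero K] (d : Equiv.Perm (Fin K)) :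
    0 < numCycles (fileTransitionGraph d) := by
  obtain ⟨rep, h1, h2, hid, h3⟩ := exists_cycle_representative d
  rw [← h3, Finset.card_pos]
  exact ⟨rep 0, by simpa using hid 0⟩

theorem numCycles_le (d : Equiv.Perm (Fin K)) :
    numCycles (fileTransitionGraph d) ≤ K := by
  obtain ⟨rep, h1, h2, hid, h3⟩ := exists_cycle_representative d
  rw [← h3]
  exact (Finset.card_le_univ _).trans (by simp)

theorem numCycles_le_of_iso {V W : Type*} [Finite W] {G : Digraph V} {H : Digraph W}
    (e : G.Adj ≃r H.Adj) : numCycles G ≤ numCycles H := by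
  classical
  unfold numCycles
  have hfin : {c : Cycle W | c ≠ Cycle.nil ∧ c.Nodup ∧ c.Chain H.Adj}.Finite := by
    have : Finite {c : Cycle W // c.Nodup} := by
      cases nonempty_fintype W
      infer_instance
    exact (Set.finite_coe_iff.1 this : {c : Cycle W | c.Nodup}.Finite).subset fun c hc => hc.2.1
  refine Set.ncard_le_ncard_of_injOn (Cycle.map e) ?_ ?_ hfin
  · rintro c ⟨h1, h2, h3⟩
    refine ⟨?_, ?_, ?_⟩
    · simpa using h1
    · induction c using Quotient.inductionOn' with | _ l
      exact List.Nodup.map e.injective h2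
    · rw [Cycle.chain_map]
      exact Cycle.Chain.imp (fun a b h => e.map_rel_iff.2 h) h3
  · intro c _ c' _ h
    have h' := congrArg (Cycle.map e.symm) h
    have key : ∀ c : Cycle V, Cycle.map e.symm (Cycle.map e c) = c := by
      intro c
      induction c using Quotient.inductionOn' with | _ l
      change ((List.map e.symm (List.map e l) : List V) : Cycle V) = (l : Cycle V)
      simp
    rwa [key, key] at h'

theorem numCycles_congr {V W : Type*} [Finite V] [Finite W] {G : Digraph V} {H : Digraph W}
    (e : G.Adj ≃r H.Adj) : numCycles G = numCycles H :=
  le_antisymm (numCycles_le_of_iso e) (numCycles_le_of_iso e.symm)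

/-- A graph isomorphism is a relabelling of the workers that conjugates one permutation into the
other; so `avgLoad` averages over a conjugacy class. -/
theorem mem_assignments {d d' : Equiv.Perm (Fin K)} :
    d' ∈ assignments (fileTransitionGraph d) ↔ ∃ p : Equiv.Perm (Fin K), d' = p * d * p⁻¹ := by
  simp only [assignments, Finset.mem_filter]
  constructor
  · rintro ⟨-, ⟨e⟩⟩
    refine ⟨e.symm.toEquiv, ?_⟩
    ext1 l
    have h' : d (e l) = e (d' l) := (e.map_rel_iff (a := d' l) (b := l)).2 rfl
    have hinv : ∀ y, (e.symm.toEquiv)⁻¹ y = e y := fun y => rfl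
    rw [Equiv.Perm.mul_apply, Equiv.Perm.mul_apply, hinv, h']
    exact (e.symm_apply_apply _).symm
  · rintro ⟨p, rfl⟩
    refine ⟨Finset.mem_univ _, ⟨⟨p⁻¹, ?_⟩⟩⟩
    intro a b
    simp only [fileTransitionGraph]
    rw [Equiv.Perm.mul_apply, Equiv.Perm.mul_apply, Equiv.Perm.eq_inv_iff_eq]

theorem self_mem_assignments (d : Equiv.Perm (Fin K)) :
    d ∈ assignments (fileTransitionGraph d) :=
  mem_assignments.2 ⟨1, by simp⟩

theorem numCycles_eq_of_mem_assignments {d d' : Equiv.Perm (Fin K)}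
    (h : d' ∈ assignments (fileTransitionGraph d)) :
    numCycles (fileTransitionGraph d') = numCycles (fileTransitionGraph d) := by
  simp only [assignments, Finset.mem_filter] at h
  obtain ⟨-, ⟨e⟩⟩ := h
  exact numCycles_congr e

theorem exists_numCycles_eq_one (hK : 0 < K) :
    ∃ d : Equiv.Perm (Fin K), numCycles (fileTransitionGraph d) = 1 := by
  have : NeZero K := ⟨hK.ne'⟩
  refine ⟨finRotate K, ?_⟩
  obtain ⟨rep, h1, h2, hid, h3⟩ := exists_cycle_representative (finRotate K)
  refine le_antisymm ?_ (numCycles_pos _)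
  have hconst : ∀ x, rep x = rep 0 := by
    obtain ⟨n, rfl⟩ := Nat.exists_eq_succ_of_ne_zero hK.ne'
    intro x
    induction x using Fin.induction with
    | zero => rfl
    | succ i ih =>
      rw [← ih, ← h1 i.castSucc, finRotate_apply]
      congr 1
      simp
  rw [← h3, Finset.card_le_one]
  intro a ha b hb
  rw [Finset.mem_filter] at ha hb
  rw [← ha.2, ← hb.2, hconst a, hconst b]

/-- There is an injective sequence of workers, all but one from each cycle, in which the next file of
no worker is currently processed by this worker or an earlier one. -/
theorem exists_acyclic_order (d : Equiv.Perm (Fin K)) :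
    ∃ L : Fin (K - numCycles (fileTransitionGraph d)) → Fin K, Injective L ∧
      ∀ j k, k ≤ j → L k ≠ d (L j) := by
  classical
  obtain ⟨rep, h1, h2, hid, h3⟩ := exists_cycle_representative d
  -- The number of steps along `d` to the representative; off the representatives it drops under
  -- `d`.
  let h : Fin K → ℕ := fun x => Nat.find (h2 x)
  have hspec : ∀ x, d^[h x] x = rep x := fun x => Nat.find_spec (h2 x)
  have hdec : ∀ x, rep x ≠ x → h (d x) < h x := by
    intro x hx
    have hpos : h x ≠ 0 := by
      intro h0
      have := hspec x
      rw [h0] at this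
      exact hx this.symm
    obtain ⟨n, hn⟩ := Nat.exists_eq_succ_of_ne_zero hpos
    have : h (d x) ≤ n := by
      apply Nat.find_min'
      rw [h1, ← hspec x, hn, iterate_succ_apply]
    omega
  let U : Finset (Fin K) := Finset.univ.filter fun x => rep x ≠ x
  have hU : U.card = K - numCycles (fileTransitionGraph d) := by
    have := Finset.card_filter_add_card_filter_not (s := (Finset.univ : Finset (Fin K)))
      (fun x => rep x = x)
    rw [h3] at this
    simp only [Finset.card_univ, Fintype.card_fin] at this
    change (Finset.univ.filter fun x => ¬ rep x = x).card = _
    omega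
  let e : Fin (K - numCycles (fileTransitionGraph d)) ≃ U :=
    (Fintype.equivFinOfCardEq (by simpa using hU)).symm
  -- The order dual sorts by decreasing height: `d (L j)` is strictly lower than `L j`, hence than
  -- every earlier entry.
  let g : Fin (K - numCycles (fileTransitionGraph d)) → ℕᵒᵈ := fun k => OrderDual.toDual (h (e k))
  refine ⟨fun k => e (Tuple.sort g k), ?_, ?_⟩
  · exact Subtype.val_injective.comp (e.injective.comp (Tuple.sort g).injective)
  · intro j k hkj heq
    have hm : h (e (Tuple.sort g j)) ≤ h (e (Tuple.sort g k)) := Tuple.monotone_sort g hkj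
    have hj : rep (e (Tuple.sort g j)) ≠ e (Tuple.sort g j) :=
      (Finset.mem_filter.1 (e (Tuple.sort g j)).2).2
    have := hdec _ hj
    rw [← heq] at this
    exact absurd this (not_lt.2 hm)

end DataShuffling
-- Corner loads and their convex envelope
namespace DataShuffling

/-- Alternative form of the corner load. -/
noncomputable def cornerSum (K γ m : ℕ) : ℝ :=
  ∑ j ∈ Finset.range (K - γ), (m.choose (j + 1) : ℝ) / ((K - 1).choose (j + 1) : ℝ)

theorem sum_choose_descending (n k : ℕ) : ∀ t, t ≤ n →
    ∑ j ∈ Finset.range t, (n - 1 - j).choose k + (n - t).choose (k + 1) = n.choose (k + 1) := by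
  intro t
  induction t with
  | zero => simp
  | succ t ih =>
    intro ht
    rw [← ih (by omega), Finset.sum_range_succ, add_assoc]
    congr 1
    obtain ⟨m, hm⟩ : ∃ m, n - t = m + 1 := ⟨n - t - 1, by omega⟩
    rw [hm, Nat.choose_succ_succ]
    congr 2 <;> omega

theorem choose_sub_mul_choose {n j w : ℕ} (hj : j ≤ n) (hw : w ≤ n) :
    (n - j).choose w * n.choose j = (n - w).choose j * n.choose w := by
  by_cases h : w + j ≤ n
  · have h1 := Nat.choose_mul (n := n) (k := w + j) (s := j) (by omega)
    have h2 := Nat.choose_mul (n := n) (k := w + j) (s := w) (by omega)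
    have h3 : (w + j).choose j = (w + j).choose w := by
      rw [← Nat.choose_symm_add, ]
    rw [Nat.add_sub_cancel] at h1
    rw [Nat.add_sub_cancel_left] at h2
    rw [h3] at h1
    rw [mul_comm, ← h1, h2, mul_comm]
  · rw [Nat.choose_eq_zero_of_lt (by omega : n - j < w),
      Nat.choose_eq_zero_of_lt (by omega : n - w < j)]
    simp

/-- The hockey-stick identity splits the numerator into terms `(K-2-j choose s-1)`;
`choose_sub_mul_choose` exchanges the roles of `s - 1` and `j + 1` in each quotient. -/
theorem cornerLoad_eq_cornerSum {K γ s : ℕ} (hγ : 1 ≤ γ) (hγK : γ ≤ K) (hs : 1 ≤ s) (hsK : s ≤ K) :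
    cornerLoad K γ s = cornerSum K γ (K - s) := by
  unfold cornerLoad cornerSum
  obtain ⟨w, rfl⟩ : ∃ w, s = w + 1 := ⟨s - 1, by omega⟩
  have h := sum_choose_descending (K - 1) w (K - γ) (by omega)
  have hγ' : K - 1 - (K - γ) = γ - 1 := by omega
  rw [hγ'] at h
  rw [← h, Nat.add_sub_cancel]
  push_cast
  rw [add_sub_cancel_right, Finset.sum_div]
  refine Finset.sum_congr rfl fun j hj => ?_
  have hj' := Finset.mem_range.1 hj
  have h1 := choose_sub_mul_choose (n := K - 1) (j := j + 1) (w := w) (by omega) (by omega)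
  have e1 : K - 1 - (j + 1) = K - 1 - 1 - j := by omega
  have e2 : K - 1 - w = K - (w + 1) := by omega
  rw [e1, e2] at h1
  have p1 : ((K - 1).choose w : ℝ) ≠ 0 := by
    exact_mod_cast (Nat.choose_pos (by omega)).ne'
  have p2 : ((K - 1).choose (j + 1) : ℝ) ≠ 0 := by
    exact_mod_cast (Nat.choose_pos (by omega)).ne'
  rw [div_eq_div_iff p1 p2]
  exact_mod_cast h1

/-- Discrete convexity: by Pascal's rule the increments of `m ↦ (m choose j+1)` are `(m choose j)`,
which are monotone in `m`. The line also touches at `n + 1`. -/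
theorem choose_support (n j : ℕ) (m : ℕ) :
    (n.choose (j + 1) : ℝ) + n.choose j * ((m : ℝ) - n) ≤ m.choose (j + 1) := by
  rcases le_total n m with h | h
  · induction m, h using Nat.le_induction with
    | base => simp
    | succ m hm ih =>
      rw [Nat.choose_succ_succ]
      have : (n.choose j : ℝ) ≤ m.choose j := by exact_mod_cast Nat.choose_le_choose j hm
      push_cast
      nlinarith
  · induction h using Nat.decreasingInduction with
    | self => simp
    | of_succ m hm ih =>
      rw [Nat.choose_succ_succ] at ih
      have : (m.choose j : ℝ) ≤ n.choose j := by
        exact_mod_cast Nat.choose_le_choose j (le_of_lt hm)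
      push_cast at ih
      nlinarith

/-- The slope of the support line of `cornerSum` between `n` and `n + 1`. -/
noncomputable def cornerSlope (K γ n : ℕ) : ℝ :=
  ∑ j ∈ Finset.range (K - γ), (n.choose j : ℝ) / ((K - 1).choose (j + 1) : ℝ)

theorem cornerSum_support (K γ n m : ℕ) :
    cornerSum K γ n + cornerSlope K γ n * ((m : ℝ) - n) ≤ cornerSum K γ m := by
  unfold cornerSum cornerSlope
  rw [Finset.sum_mul, ← Finset.sum_add_distrib]
  refine Finset.sum_le_sum fun j _ => ?_
  have h := div_le_div_of_nonneg_right (choose_support n j m)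
    (Nat.cast_nonneg (α := ℝ) ((K - 1).choose (j + 1)))
  refine le_trans (le_of_eq ?_) h
  ring

theorem cornerSum_succ (K γ n : ℕ) :
    cornerSum K γ (n + 1) = cornerSum K γ n + cornerSlope K γ n := by
  unfold cornerSum cornerSlope
  rw [← Finset.sum_add_distrib]
  refine Finset.sum_congr rfl fun j _ => ?_
  rw [Nat.choose_succ_succ]
  push_cast
  ring

theorem cornerSum_nonneg (K γ n : ℕ) : 0 ≤ cornerSum K γ n :=
  Finset.sum_nonneg fun _ _ => by positivity

theorem cornerSum_zero (K γ : ℕ) : cornerSum K γ 0 = 0 := by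
  unfold cornerSum
  simp

variable {K γ : ℕ}

theorem le_of_mem_convexHull_cornerPoints (hγ : 1 ≤ γ) (hγK : γ ≤ K) {n : ℕ} {p : ℝ × ℝ}
    (hp : p ∈ convexHull ℝ (cornerPoints K γ)) :
    cornerSum K γ n + cornerSlope K γ n * ((K : ℝ) - p.1 - n) ≤ p.2 := by
  have hconv : Convex ℝ {p : ℝ × ℝ |
      cornerSum K γ n + cornerSlope K γ n * ((K : ℝ) - p.1 - n) ≤ p.2} := by
    intro p hp q hq a b ha hb hab
    simp only [Set.mem_ofPred_eq, Prod.fst_add, Prod.snd_add, Prod.smul_fst, Prod.smul_snd,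
      smul_eq_mul] at hp hq ⊢
    obtain rfl : b = 1 - a := by linarith
    nlinarith [mul_le_mul_of_nonneg_left hp ha, mul_le_mul_of_nonneg_left hq hb]
  refine convexHull_min ?_ hconv hp
  rintro _ ⟨s, h1, h2, rfl⟩
  have h := cornerSum_support K γ n (K - s)
  rw [Nat.cast_sub h2] at h
  simpa [cornerLoad_eq_cornerSum hγ hγK h1 h2] using h

theorem nonneg_of_mem_convexHull_cornerPoints (hγ : 1 ≤ γ) (hγK : γ ≤ K) {p : ℝ × ℝ}
    (hp : p ∈ convexHull ℝ (cornerPoints K γ)) : 0 ≤ p.2 := by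
  have hconv : Convex ℝ {p : ℝ × ℝ | 0 ≤ p.2} :=
    (convex_Ici (𝕜 := ℝ) (0 : ℝ)).is_linear_preimage (f := fun p : ℝ × ℝ => p.2) ⟨by simp, by simp⟩
  refine convexHull_min ?_ hconv hp
  rintro _ ⟨s, h1, h2, rfl⟩
  change 0 ≤ cornerLoad K γ s
  rw [cornerLoad_eq_cornerSum hγ hγK h1 h2]
  exact cornerSum_nonneg _ _ _

/-- The corner `(K, 0)` lies in the hull and all heights are nonnegative, so moving from `(x, y)`
towards it up to abscissa `S` does not raise the height. This absorbs unused cache memory. -/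
theorem lowerConvexEnvelope_le_of_mem (hγ : 1 ≤ γ) (hγK : γ ≤ K) {x y S : ℝ}
    (hp : (x, y) ∈ convexHull ℝ (cornerPoints K γ)) (hxS : x ≤ S) (hSK : S ≤ K) :
    lowerConvexEnvelope (cornerPoints K γ) S ≤ y := by
  have hy : 0 ≤ y := nonneg_of_mem_convexHull_cornerPoints hγ hγK hp
  have hbdd : BddBelow {y : ℝ | (S, y) ∈ convexHull ℝ (cornerPoints K γ)} :=
    ⟨0, fun z hz => nonneg_of_mem_convexHull_cornerPoints hγ hγK hz⟩
  rcases hxS.eq_or_lt with rfl | hlt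
  · exact csInf_le hbdd hp
  · have hK : ((K : ℝ), (0 : ℝ)) ∈ convexHull ℝ (cornerPoints K γ) := by
      apply subset_convexHull
      refine ⟨K, by omega, le_rfl, ?_⟩
      rw [cornerLoad_eq_cornerSum hγ hγK (by omega) le_rfl, Nat.sub_self, cornerSum_zero]
    have hpos : 0 < (K : ℝ) - x := by linarith
    have ha : 0 ≤ ((K : ℝ) - S) / (K - x) := div_nonneg (by linarith) hpos.le
    have hb : 0 ≤ (S - x) / ((K : ℝ) - x) := div_nonneg (by linarith) hpos.le
    have hab : ((K : ℝ) - S) / (K - x) + (S - x) / ((K : ℝ) - x) = 1 := by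
      field_simp
      ring
    have hmem := (convex_convexHull ℝ (cornerPoints K γ)) hp hK ha hb hab
    have hx : ((K : ℝ) - S) / (K - x) * x + (S - x) / ((K : ℝ) - x) * K = S := by
      field_simp
      ring
    have hle : ((K : ℝ) - S) / (K - x) ≤ 1 := by linarith
    have heq : (((K : ℝ) - S) / (K - x)) • (x, y) + ((S - x) / ((K : ℝ) - x)) • ((K : ℝ), (0 : ℝ))
        = (S, ((K : ℝ) - S) / (K - x) * y) := by
      ext
      · simpa using hx
      · simp
    rw [heq] at hmem
    exact (csInf_le hbdd hmem).trans (by nlinarith)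

/-- Lower bounds on the envelope need this, since `sInf ∅ = 0`. -/
theorem convexHull_fiber_nonempty (hK : 0 < K) {S : ℝ} (h1 : 1 ≤ S) (h2 : S ≤ K) :
    {y : ℝ | (S, y) ∈ convexHull ℝ (cornerPoints K γ)}.Nonempty := by
  have hA : ((1 : ℕ) : ℝ) ∈ Prod.fst '' (cornerPoints K γ) :=
    ⟨_, ⟨1, le_rfl, hK, rfl⟩, rfl⟩
  have hB : (K : ℝ) ∈ Prod.fst '' (cornerPoints K γ) :=
    ⟨_, ⟨K, hK, le_rfl, rfl⟩, rfl⟩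
  have hS : S ∈ convexHull ℝ (Prod.fst '' (cornerPoints K γ)) := by
    refine segment_subset_convexHull hA hB ?_
    rw [segment_eq_Icc (by exact_mod_cast hK)]
    exact ⟨by simpa using h1, h2⟩
  have himg : convexHull ℝ ((LinearMap.fst ℝ ℝ ℝ) '' (cornerPoints K γ)) =
      (LinearMap.fst ℝ ℝ ℝ) '' convexHull ℝ (cornerPoints K γ) :=
    ((LinearMap.fst ℝ ℝ ℝ).image_convexHull _).symm
  have hS' : S ∈ (LinearMap.fst ℝ ℝ ℝ) '' convexHull ℝ (cornerPoints K γ) := by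
    rw [← himg]; exact hS
  obtain ⟨⟨x, y⟩, hp, hx⟩ := hS'
  simp only [LinearMap.fst_apply] at hx
  subst hx
  exact ⟨y, hp⟩

theorem le_lowerConvexEnvelope (hγ : 1 ≤ γ) (hγK : γ ≤ K) {S : ℝ} (h1 : 1 ≤ S) (h2 : S ≤ K)
    (n : ℕ) : cornerSum K γ n + cornerSlope K γ n * ((K : ℝ) - S - n) ≤
      lowerConvexEnvelope (cornerPoints K γ) S :=
  le_csInf (convexHull_fiber_nonempty (by omega) h1 h2)
    fun _ hy => le_of_mem_convexHull_cornerPoints hγ hγK hy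

theorem lowerConvexEnvelope_natCast (hγ : 1 ≤ γ) (hγK : γ ≤ K) {s : ℕ} (h1 : 1 ≤ s) (h2 : s ≤ K) :
    lowerConvexEnvelope (cornerPoints K γ) s = cornerLoad K γ s := by
  apply le_antisymm
  · refine lowerConvexEnvelope_le_of_mem hγ hγK (x := s) ?_ le_rfl (by exact_mod_cast h2)
    exact subset_convexHull _ _ ⟨s, h1, h2, rfl⟩
  · have h := le_lowerConvexEnvelope hγ hγK (S := s) (by exact_mod_cast h1)
      (by exact_mod_cast h2) (K - s)
    rw [Nat.cast_sub h2] at h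
    simpa [cornerLoad_eq_cornerSum hγ hγK h1 h2] using h

end DataShuffling
-- Converse: the acyclic bound
namespace DataShuffling
open Function
open scoped Nat

variable {K B : ℕ} {S : ℝ}

/-- Let only the counted bits vary and set all others to zero. The message then determines them:
worker `L j` caches, among the varying bits, only bits of files `d (L k)` with `k < j`, which are
known by induction, so it decodes `d (L j)`. Thus subsets of the counted bits inject into messages.
-/
theorem Placement.sum_card_le_of_canDeliver (Z : Placement K B S) {d : Equiv.Perm (Fin K)}
    {l m : ℕ} (h : Z.CanDeliver d l) {L : Fin m → Fin K} (hL : Injective L) :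
    ∑ j, (Finset.univ.filter fun b => ∀ k ≤ j, b ∉ Z.bits (L k) (d (L j))).card ≤ l := by
  classical
  obtain ⟨enc, hdec⟩ := h
  let A : Finset (Σ _ : Fin m, Fin B) := Finset.univ.sigma fun j =>
    Finset.univ.filter fun b => ∀ k ≤ j, b ∉ Z.bits (L k) (d (L j))
  have hA : A.card = ∑ j, (Finset.univ.filter fun b =>
    ∀ k ≤ j, b ∉ Z.bits (L k) (d (L j))).card := Finset.card_sigma _ _
  rw [← hA]
  let W : Finset (Σ _ : Fin m, Fin B) → Files K B := fun v f b =>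
    decide (∃ j, d (L j) = f ∧ (⟨j, b⟩ : Σ _ : Fin m, Fin B) ∈ v)
  have hW : ∀ v j b, W v (d (L j)) b = decide ((⟨j, b⟩ : Σ _ : Fin m, Fin B) ∈ v) := by
    intro v j b
    simp only [W]
    congr 1
    apply propext
    constructor
    · rintro ⟨j', h1, h2⟩
      rwa [hL (d.injective h1)] at h2
    · exact fun h => ⟨j, rfl, h⟩
  have hinj : ∀ v ∈ A.powerset, ∀ v' ∈ A.powerset, enc (W v) = enc (W v') → v = v' := by
    intro v hv v' hv' henc
    rw [Finset.mem_powerset] at hv hv'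
    have key : ∀ (n : ℕ) (j : Fin m), (j : ℕ) = n → ∀ b,
        ((⟨j, b⟩ : Σ _ : Fin m, Fin B) ∈ v ↔ (⟨j, b⟩ : Σ _ : Fin m, Fin B) ∈ v') := by
      intro n
      induction n using Nat.strong_induction_on with
      | _ n ih =>
        intro j hj b
        obtain ⟨dec, hd⟩ := hdec (L j)
        have hcont : Z.content (L j) (W v) = Z.content (L j) (W v') := by
          funext f ⟨b', hb'⟩
          simp only [Placement.content, W]
          congr 1
          apply propext
          have aux : ∀ v ⊆ A, ∀ j', d (L j') = f → (⟨j', b'⟩ : Σ _ : Fin m, Fin B) ∈ v →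
              (j' : ℕ) < n := by
            intro v hv j' hf hmem
            by_contra hlt
            have := hv hmem
            simp only [A, Finset.mem_sigma, Finset.mem_univ, Finset.mem_filter, true_and] at this
            refine this j (Fin.le_def.2 (by omega)) ?_
            rw [hf]
            exact hb'
          constructor
          · rintro ⟨j', h1, h2⟩
            exact ⟨j', h1, (ih _ (aux v hv j' h1 h2) j' rfl b').1 h2⟩
          · rintro ⟨j', h1, h2⟩
            exact ⟨j', h1, (ih _ (aux v' hv' j' h1 h2) j' rfl b').2 h2⟩
        have h1 := hd (W v)
        rw [henc, hcont, hd (W v')] at h1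
        have h2 := congrFun h1 b
        rw [hW, hW, decide_eq_decide] at h2
        exact h2.symm
    ext ⟨j, b⟩
    exact key _ j rfl b
  have hcard := Finset.card_le_card_of_injOn (s := A.powerset) (t := Finset.univ)
    (fun v => enc (W v)) (fun _ _ => Finset.mem_coe.2 (Finset.mem_univ _))
    (fun v hv v' hv' h => hinj v hv v' hv' h)
  rw [Finset.card_powerset, Finset.card_univ] at hcard
  simp only [Fintype.card_fun, Fintype.card_bool, Fintype.card_fin] at hcard
  exact (Nat.pow_le_pow_iff_right (by norm_num)).1 hcard

/-- Broadcasting everything always works; hence the infimum in `load` is attained and is not the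
default value of an empty set. -/
theorem Placement.exists_canDeliver (Z : Placement K B S) (d : Equiv.Perm (Fin K)) :
    ∃ l, Z.CanDeliver d l := by
  refine ⟨K * B, fun W k => W (finProdFinEquiv.symm k).1 (finProdFinEquiv.symm k).2, fun i =>
    ⟨fun M _ b => M (finProdFinEquiv (d i, b)), fun W => ?_⟩⟩
  funext b
  simp

theorem Placement.sum_card_le_load (hB : 0 < B) (Z : Placement K B S) (d : Equiv.Perm (Fin K))
    {m : ℕ} {L : Fin m → Fin K} (hL : Injective L) :
    ((∑ j, (Finset.univ.filter fun b => ∀ k ≤ j, b ∉ Z.bits (L k) (d (L j))).card : ℕ) : ℝ) ≤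
      Z.load d * B := by
  have hmem : sInf {l : ℕ | Z.CanDeliver d l} ∈ {l : ℕ | Z.CanDeliver d l} :=
    Nat.sInf_mem (Z.exists_canDeliver d)
  have hB' : (B : ℝ) ≠ 0 := by positivity
  rw [Placement.load, div_mul_cancel₀ _ hB']
  exact_mod_cast Z.sum_card_le_of_canDeliver hmem hL

/-! ### Converse: averaging over relabellings of the workers -/

theorem exists_perm_image {V : Type*} [Fintype V] [DecidableEq V] {T T' : Finset V} {g f : V}
    (hg : g ∉ T) (hf : f ∉ T') (hc : T.card = T'.card) :
    ∃ σ : Equiv.Perm V, σ g = f ∧ T.image σ = T' := by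
  obtain ⟨τ, hτ⟩ : ∃ τ : Equiv.Perm V, T.image τ = T' := by
    let e := Finset.equivOfCardEq hc
    refine ⟨e.extendSubtype, ?_⟩
    apply Finset.eq_of_subset_of_card_le
    · intro x hx
      obtain ⟨y, hy, rfl⟩ := Finset.mem_image.1 hx
      exact e.extendSubtype_mem y hy
    · rw [Finset.card_image_of_injective _ e.extendSubtype.injective, hc]
  refine ⟨Equiv.swap (τ g) f * τ, by simp, ?_⟩
  rw [← hτ]
  apply Finset.image_congr
  intro x hx
  have h1 : τ x ∈ T' := hτ ▸ Finset.mem_image_of_mem _ hx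
  rw [Equiv.Perm.mul_apply]
  apply Equiv.swap_apply_of_ne_of_ne
  · intro h
    exact hg (τ.injective h ▸ hx)
  · rintro rfl
    exact hf h1

/-- Left translation by a permutation taking `(g, T)` to `(f, T')` matches the two sets, so the
count does not depend on the target. -/
theorem card_perm_image {V : Type*} [Fintype V] [DecidableEq V] {T T' : Finset V} {g f : V}
    (hg : g ∉ T) (hf : f ∉ T') (hc : T.card = T'.card) :
    (Finset.univ.filter fun p : Equiv.Perm V => p g = f ∧ T.image p = T').card =
      (Finset.univ.filter fun p : Equiv.Perm V => p g = g ∧ T.image p = T).card := by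
  obtain ⟨σ, h1, h2⟩ := exists_perm_image hg hf hc
  symm
  refine Finset.card_equiv (Equiv.mulLeft σ) fun p => ?_
  simp only [Finset.mem_filter, Finset.mem_univ, true_and, Equiv.coe_mulLeft]
  have e1 : (σ * p) g = f ↔ p g = g := by
    rw [Equiv.Perm.mul_apply, ← h1]
    exact σ.injective.eq_iff
  have e2 : T.image (σ * p) = T' ↔ T.image p = T := by
    rw [← h2, Equiv.Perm.coe_mul, ← Finset.image_image]
    exact (Finset.image_injective σ.injective).eq_iff
  rw [e1, e2]

theorem card_perm_disjoint_aux {V : Type*} [Fintype V] [DecidableEq V] {T C : Finset V} {g f : V}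
    (hg : g ∉ T) (hf : f ∈ C) :
    (Finset.univ.filter fun p : Equiv.Perm V => p g = f ∧ Disjoint (T.image p) C).card =
      (Fintype.card V - C.card).choose T.card *
      (Finset.univ.filter fun p : Equiv.Perm V => p g = g ∧ T.image p = T).card := by
  rw [Finset.card_eq_sum_card_fiberwise (f := fun p : Equiv.Perm V => T.image p)
    (t := Cᶜ.powersetCard T.card)]
  · rw [Finset.sum_const_nat (m := (Finset.univ.filter fun p : Equiv.Perm V =>
      p g = g ∧ T.image p = T).card), Finset.card_powersetCard, Finset.card_compl]
    intro T' hT'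
    obtain ⟨h1, h2⟩ := Finset.mem_powersetCard.1 hT'
    have hfT' : f ∉ T' := fun h => (Finset.mem_compl.1 (h1 h)) hf
    rw [← card_perm_image hg hfT' h2.symm]
    congr 1
    ext p
    simp only [Finset.mem_filter, Finset.mem_univ, true_and]
    constructor
    · rintro ⟨⟨h3, -⟩, h4⟩
      exact ⟨h3, h4⟩
    · rintro ⟨h3, h4⟩
      exact ⟨⟨h3, h4 ▸ Finset.subset_compl_iff_disjoint_right.1 h1⟩, h4⟩
  · intro p hp
    have hp' := (Finset.mem_filter.1 (Finset.mem_coe.1 hp)).2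
    refine Finset.mem_coe.2 (Finset.mem_powersetCard.2 ⟨?_, ?_⟩)
    · exact Finset.subset_compl_iff_disjoint_right.2 hp'.2
    · exact Finset.card_image_of_injective _ p.injective

/-- The image of `(g, T)` under a uniform permutation is uniform over pairs of a point and a
`T.card`-set avoiding it. With the point fixed at `f ∈ C`, the favourable sets are those inside the
complement of `C`. -/
theorem card_perm_disjoint {V : Type*} [Fintype V] [DecidableEq V] {T C : Finset V} {g f : V}
    (hg : g ∉ T) (hf : f ∈ C) :
    (Finset.univ.filter fun p : Equiv.Perm V => p g = f ∧ Disjoint (T.image p) C).card *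
      (Fintype.card V * (Fintype.card V - 1).choose T.card) =
      (Fintype.card V)! * (Fintype.card V - C.card).choose T.card := by
  have htot : (Fintype.card V)! = Fintype.card V * ((Fintype.card V - 1).choose T.card *
      (Finset.univ.filter fun p : Equiv.Perm V => p g = g ∧ T.image p = T).card) := by
    rw [← Fintype.card_perm, ← Finset.card_univ,
      Finset.card_eq_sum_card_fiberwise (f := fun p : Equiv.Perm V => p g) (t := Finset.univ)
      (fun _ _ => Finset.mem_coe.2 (Finset.mem_univ _)), Finset.sum_const_nat, Finset.card_univ]
    intro f _
    have h := card_perm_disjoint_aux hg (Finset.mem_singleton_self f)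
    rw [Finset.card_singleton] at h
    rw [← h]
    congr 1
    ext p
    simp only [Finset.mem_filter, Finset.mem_univ, true_and, Finset.disjoint_singleton_right,
      iff_self_and]
    rintro rfl hmem
    obtain ⟨x, hx, hxg⟩ := Finset.mem_image.1 hmem
    exact hg (p.injective hxg ▸ hx)
  rw [card_perm_disjoint_aux hg hf, htot]
  ring

/-- The workers that cache bit `b` of file `f`. -/
def Placement.cachers (Z : Placement K B S) (f : Fin K) (b : Fin B) : Finset (Fin K) :=
  Finset.univ.filter fun w => b ∈ Z.bits w f

theorem Placement.self_mem_cachers (Z : Placement K B S) (f : Fin K) (b : Fin B) :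
    f ∈ Z.cachers f b := by
  simp [Placement.cachers, Z.processing]

theorem Placement.sum_perm_card (Z : Placement K B S) {T : Finset (Fin K)} {g : Fin K}
    (hg : g ∉ T) :
    ∑ p : Equiv.Perm (Fin K),
      ((Finset.univ.filter fun b => ∀ w ∈ T, b ∉ Z.bits (p w) (p g)).card : ℝ) =
    (K ! : ℝ) / K * ∑ f, ∑ b, ((K - (Z.cachers f b).card).choose T.card : ℝ) /
      ((K - 1).choose T.card : ℝ) := by
  have hcard : T.card ≤ K - 1 := by
    have := Finset.card_le_univ (insert g T)
    rw [Finset.card_insert_of_notMem hg, Fintype.card_fin] at this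
    omega
  have hK : 0 < K := g.pos
  have hc : ((K - 1).choose T.card : ℝ) ≠ 0 := by
    exact_mod_cast (Nat.choose_pos hcard).ne'
  have hK' : (K : ℝ) ≠ 0 := by positivity
  have h1 : ∀ p : Equiv.Perm (Fin K),
      ((Finset.univ.filter fun b => ∀ w ∈ T, b ∉ Z.bits (p w) (p g)).card : ℝ) =
      ∑ f, ∑ b, if p g = f ∧ Disjoint (T.image p) (Z.cachers f b) then (1 : ℝ) else 0 := by
    intro p
    rw [Finset.sum_comm, Finset.card_filter]
    push_cast
    refine Finset.sum_congr rfl fun b _ => ?_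
    rw [Finset.sum_eq_single (p g)]
    · refine if_congr ?_ rfl rfl
      simp [Finset.disjoint_left, Placement.cachers]
    · intro f _ hf
      rw [if_neg]
      exact fun h => hf h.1.symm
    · simp
  simp_rw [h1]
  rw [Finset.sum_comm, Finset.mul_sum]
  refine Finset.sum_congr rfl fun f _ => ?_
  rw [Finset.sum_comm, Finset.mul_sum]
  refine Finset.sum_congr rfl fun b _ => ?_
  rw [Finset.sum_boole]
  have h := card_perm_disjoint hg (Z.self_mem_cachers f b)
  rw [Fintype.card_fin] at h
  have h' : ((Finset.univ.filter fun p : Equiv.Perm (Fin K) =>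
      p g = f ∧ Disjoint (T.image p) (Z.cachers f b)).card : ℝ) *
      ((K : ℝ) * ((K - 1).choose T.card : ℝ)) =
      (K ! : ℝ) * ((K - (Z.cachers f b).card).choose T.card : ℝ) := by exact_mod_cast h
  rw [div_mul_div_comm, eq_div_iff (mul_ne_zero hK' hc), h']

theorem Placement.sum_conj_load_ge (hB : 0 < B) (Z : Placement K B S)
    (d : Equiv.Perm (Fin K)) :
    (K ! : ℝ) / K * ∑ f, ∑ b, cornerSum K (numCycles (fileTransitionGraph d))
      (K - (Z.cachers f b).card) ≤
    (∑ p : Equiv.Perm (Fin K), Z.load (p * d * p⁻¹)) * B := by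
  obtain ⟨L, hL, hd⟩ := exists_acyclic_order d
  rw [Finset.sum_mul]
  have hle := Finset.sum_le_sum fun (p : Equiv.Perm (Fin K)) (_ : p ∈ Finset.univ) =>
    Z.sum_card_le_load hB (p * d * p⁻¹) (p.injective.comp hL)
  refine le_trans (le_of_eq ?_) hle
  simp only [Nat.cast_sum]
  conv_rhs => rw [Finset.sum_comm]
  have hj : ∀ j, ∑ p : Equiv.Perm (Fin K), ((Finset.univ.filter fun b => ∀ k ≤ j,
      b ∉ Z.bits ((p ∘ L) k) ((p * d * p⁻¹) ((p ∘ L) j))).card : ℝ) =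
      (K ! : ℝ) / K * ∑ f, ∑ b, ((K - (Z.cachers f b).card).choose (j + 1) : ℝ) /
      ((K - 1).choose (j + 1) : ℝ) := by
    intro j
    -- Acyclicity enters here: a wanted file processed inside the prefix would be cached there
    -- completely and contribute nothing.
    have hg : d (L j) ∉ (Finset.Iic j).image L := by
      intro h
      obtain ⟨k, hk, hkd⟩ := Finset.mem_image.1 h
      exact hd j k (Finset.mem_Iic.1 hk) hkd
    have h := Z.sum_perm_card hg
    rw [Finset.card_image_of_injective _ hL, Fin.card_Iic] at h
    rw [← h]
    refine Finset.sum_congr rfl fun p _ => ?_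
    simp
  refine Eq.trans ?_ (Finset.sum_congr rfl fun j _ => (hj j).symm)
  rw [← Finset.mul_sum]
  conv_rhs => rw [Finset.sum_comm]
  congr 1
  refine Finset.sum_congr rfl fun f _ => ?_
  rw [Finset.sum_comm]
  refine Finset.sum_congr rfl fun b _ => ?_
  rw [cornerSum, Finset.sum_range]

/-- Conjugation permutes the class, so summing the loads over all conjugates of all its members
counts the class sum `K!` times. -/
theorem Placement.sum_assignments_load_ge (hB : 0 < B) (Z : Placement K B S)
    (d : Equiv.Perm (Fin K)) :
    ((assignments (fileTransitionGraph d)).card : ℝ) *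
      ((1 / (K * B) : ℝ) * ∑ f, ∑ b, cornerSum K (numCycles (fileTransitionGraph d))
      (K - (Z.cachers f b).card)) ≤
    ∑ d' ∈ assignments (fileTransitionGraph d), Z.load d' := by
  set A := assignments (fileTransitionGraph d) with hA
  set X := ∑ f, ∑ b, cornerSum K (numCycles (fileTransitionGraph d))
      (K - (Z.cachers f b).card) with hX
  have hconj : ∀ p : Equiv.Perm (Fin K), ∑ d' ∈ A, Z.load (p * d' * p⁻¹) = ∑ d' ∈ A, Z.load d' := by
    intro p
    refine Finset.sum_equiv (MulAut.conj p).toEquiv ?_ ?_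
    · intro d'
      simp only [hA, mem_assignments]
      constructor
      · rintro ⟨q, rfl⟩
        exact ⟨p * q, by simp [mul_assoc]⟩
      · rintro ⟨q, hq⟩
        refine ⟨p⁻¹ * q, ?_⟩
        have : p * d' * p⁻¹ = q * d * q⁻¹ := hq
        calc d' = p⁻¹ * (p * d' * p⁻¹) * p := by group
          _ = _ := by rw [this]; group
    · intro d' _
      rfl
  have hsum : (A.card : ℝ) * ((K ! : ℝ) / K * X) ≤ (K ! : ℝ) * (∑ d' ∈ A, Z.load d') * B := by
    have h1 : ∑ d' ∈ A, (∑ p : Equiv.Perm (Fin K), Z.load (p * d' * p⁻¹)) * (B : ℝ) =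
        (K ! : ℝ) * (∑ d' ∈ A, Z.load d') * B := by
      rw [← Finset.sum_mul, Finset.sum_comm]
      simp_rw [hconj]
      rw [Finset.sum_const, Finset.card_univ, Fintype.card_perm, Fintype.card_fin, nsmul_eq_mul]
    rw [← h1, ← nsmul_eq_mul]
    refine Finset.card_nsmul_le_sum _ _ _ fun d' hd' => ?_
    have h2 := Z.sum_conj_load_ge hB d'
    rwa [numCycles_eq_of_mem_assignments hd'] at h2
  have hf : (0 : ℝ) < (K ! : ℝ) := by exact_mod_cast Nat.factorial_pos K
  have hB' : (0 : ℝ) < B := by exact_mod_cast hB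
  have h3 : (A.card : ℝ) * ((1 / (K * B) : ℝ) * X) =
      ((A.card : ℝ) * ((K ! : ℝ) / K * X)) / ((K ! : ℝ) * B) := by
    field_simp
  rw [h3, div_le_iff₀ (by positivity)]
  linarith

theorem Placement.avgLoad_ge (hK : 0 < K) (hB : 0 < B) (hS : S ≤ K) (Z : Placement K B S)
    (d : Equiv.Perm (Fin K)) :
    lowerConvexEnvelope (cornerPoints K (numCycles (fileTransitionGraph d))) S ≤
      Z.avgLoad (fileTransitionGraph d) := by
  have : NeZero K := ⟨hK.ne'⟩
  set γ := numCycles (fileTransitionGraph d) with hγ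
  have hγ1 : 1 ≤ γ := numCycles_pos d
  have hγK : γ ≤ K := numCycles_le d
  have hA : (0 : ℝ) < (assignments (fileTransitionGraph d)).card := by
    exact_mod_cast Finset.card_pos.2 ⟨d, self_mem_assignments d⟩
  have hB' : (0 : ℝ) < B := by exact_mod_cast hB
  have hK' : (0 : ℝ) < K := by exact_mod_cast hK
  have hge : (1 / (K * B) : ℝ) * ∑ f, ∑ b, cornerSum K γ (K - (Z.cachers f b).card) ≤
      Z.avgLoad (fileTransitionGraph d) := by
    rw [Placement.avgLoad, le_div_iff₀ hA, mul_comm]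
    exact Z.sum_assignments_load_ge hB d
  refine le_trans ?_ hge
  have hx : (1 / (K * B) : ℝ) * ∑ f, ∑ b, ((Z.cachers f b).card : ℝ) ≤ S := by
    have hcap : ∑ f, ∑ b, ((Z.cachers f b).card : ℝ) ≤ K * (S * B) := by
      have h1 : ∑ f, ∑ b, ((Z.cachers f b).card : ℝ) =
          ∑ j, ((∑ f, (Z.bits j f).card : ℕ) : ℝ) := by
        push_cast
        conv_rhs => rw [Finset.sum_comm]
        refine Finset.sum_congr rfl fun f _ => ?_
        have h2 : ∀ b, ((Z.cachers f b).card : ℝ) =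
            ∑ j, if b ∈ Z.bits j f then (1 : ℝ) else 0 := by
          intro b
          rw [Finset.sum_boole, Placement.cachers]
        simp_rw [h2]
        rw [Finset.sum_comm]
        refine Finset.sum_congr rfl fun j _ => ?_
        rw [Finset.sum_boole, Finset.filter_univ_mem]
      rw [h1]
      calc _ ≤ ∑ _j : Fin K, S * (B : ℝ) := Finset.sum_le_sum fun j _ => Z.capacity j
        _ = _ := by simp
    rw [one_div, inv_mul_le_iff₀ (by positivity)]
    linarith
  refine lowerConvexEnvelope_le_of_mem hγ1 hγK ?_ hx hS
  -- Each bit of each file gives the corner at its number of cachers, which is at least 1 because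
  -- the processing worker caches it; the `K * B` bits have equal weight.
  have hmem := (convex_convexHull ℝ (cornerPoints K γ)).sum_mem
    (t := (Finset.univ : Finset (Fin K × Fin B))) (w := fun _ => (1 / (K * B) : ℝ))
    (z := fun q => (((Z.cachers q.1 q.2).card : ℝ), cornerSum K γ (K - (Z.cachers q.1 q.2).card)))
    (fun _ _ => by positivity) ?_ ?_
  · convert hmem using 1
    rw [← Finset.smul_sum, Fintype.sum_prod_type]
    ext
    · simp [Prod.fst_sum]
    · simp [Prod.snd_sum]
  · rw [Finset.sum_const, Finset.card_univ, Fintype.card_prod, Fintype.card_fin, Fintype.card_fin,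
      nsmul_eq_mul]
    push_cast
    field_simp
  · intro q _
    apply subset_convexHull
    have h1 : 1 ≤ (Z.cachers q.1 q.2).card := Finset.card_pos.2 ⟨_, Z.self_mem_cachers _ _⟩
    have h2 : (Z.cachers q.1 q.2).card ≤ K := (Finset.card_le_univ _).trans (by simp)
    exact ⟨_, h1, h2, by rw [cornerLoad_eq_cornerSum hγ1 hγK h1 h2]⟩

end DataShuffling
-- Achievability: chains modulo two
namespace DataShuffling
open Function

section ChainComplex

theorem sum_offDiag_symm_eq_zero {V : Type*} [DecidableEq V] (s : Finset V) (g : V → V → ZMod 2) (hg : ∀ a b, g a b = g b a) :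
    ∑ p ∈ s.offDiag, g p.1 p.2 = 0 := by
  refine Finset.sum_involution (fun p _ => p.swap) ?_ ?_ ?_ ?_
  · intro p _
    rw [Prod.fst_swap, Prod.snd_swap, hg p.2 p.1]
    exact CharTwo.add_self_eq_zero _
  · intro p hp _ h
    exact (Finset.mem_offDiag.1 hp).2.2 (congrArg Prod.snd h)
  · intro p hp
    obtain ⟨h1, h2, h3⟩ := Finset.mem_offDiag.1 hp
    exact Finset.mem_offDiag.2 ⟨h2, h1, h3.symm⟩
  · intro p _
    exact p.swap_swap

variable {V : Type*} [Fintype V] [DecidableEq V]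

/-- The simplicial boundary modulo two. -/
def bdry (x : Finset V → ZMod 2) (A : Finset V) : ZMod 2 :=
  ∑ j ∈ Aᶜ, x (insert j A)

/-- The chain `∑ i, e i ∧ u i` modulo two. -/
def wedgeSum (u : V → Finset V → ZMod 2) (Δ : Finset V) : ZMod 2 :=
  ∑ i ∈ Δ, u i (Δ.erase i)

/-- The broadcast chain `∑ i, e i ∧ (∂ x i + ∂ x (d i))`. -/
def broadcast (d : Equiv.Perm V) (x : V → Finset V → ZMod 2) : Finset V → ZMod 2 :=
  wedgeSum fun i A => bdry (x i) A + bdry (x (d i)) A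

theorem bdry_bdry (x : Finset V → ZMod 2) (E : Finset V) : bdry (bdry x) E = 0 := by
  rw [← sum_offDiag_symm_eq_zero Eᶜ (fun j k => x (insert k (insert j E)))
    (fun a b => by rw [Finset.insert_comm])]
  unfold bdry
  rw [Finset.sum_sigma']
  refine Finset.sum_nbij' (fun p => (p.1, p.2)) (fun p => ⟨p.1, p.2⟩) ?_ ?_ ?_ ?_ ?_
  · rintro ⟨j, k⟩ h
    simp only [Finset.mem_sigma, Finset.mem_compl, Finset.mem_insert, not_or] at h
    simp only [Finset.mem_offDiag, Finset.mem_compl]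
    exact ⟨h.1, h.2.2, fun e => h.2.1 e.symm⟩
  · rintro ⟨j, k⟩ h
    simp only [Finset.mem_offDiag, Finset.mem_compl] at h
    simp only [Finset.mem_sigma, Finset.mem_compl, Finset.mem_insert, not_or]
    exact ⟨h.1, fun e => h.2.2 e.symm, h.2.1⟩
  all_goals intros; rfl

/-- The Leibniz rule modulo two: `∂ (∑ e i ∧ u i) = ∑ u i + ∑ e i ∧ ∂ u i`, and both sums vanish. -/
theorem bdry_wedgeSum {u : V → Finset V → ZMod 2} (hu : ∀ A, ∑ i, u i A = 0)
    (hb : ∀ i E, bdry (u i) E = 0) (A : Finset V) : bdry (wedgeSum u) A = 0 := by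
  have h1 : ∀ j ∈ Aᶜ, wedgeSum u (insert j A) =
      u j A + ∑ i ∈ A, u i (insert j (A.erase i)) := by
    intro j hj
    have hj' := Finset.mem_compl.1 hj
    rw [wedgeSum, Finset.sum_insert hj', Finset.erase_insert hj']
    congr 1
    refine Finset.sum_congr rfl fun i hi => ?_
    rw [Finset.erase_insert_of_ne]
    rintro rfl
    exact hj' hi
  have h2 : ∀ i ∈ A, ∑ j ∈ Aᶜ, u i (insert j (A.erase i)) = u i A := by
    intro i hi
    have h := hb i (A.erase i)
    rw [bdry, Finset.compl_erase, Finset.sum_insert (by simpa using hi),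
      Finset.insert_erase hi] at h
    exact (CharTwo.add_eq_zero.1 h).symm
  rw [bdry, Finset.sum_congr rfl h1, Finset.sum_add_distrib, Finset.sum_comm,
    Finset.sum_congr rfl h2, add_comm, Finset.sum_add_sum_compl, hu]

/-- The sets `Δ` summed over pick one worker from each cycle represented in `D`. After removing `i`
and fixing the rest `A`, the worker `i` runs over a whole cycle, which `d` permutes, so `c i` and `c
(d i)` cancel in total. -/
theorem sum_wedgeSum_fiber (d : Equiv.Perm V) {rep : V → V} (hrep : ∀ x, rep (d x) = rep x)
    (c : V → Finset V → ZMod 2) (D : Finset V) :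
    ∑ Δ ∈ Finset.univ.filter (fun Δ : Finset V => Δ.card = D.card ∧ Δ.image rep = D),
      wedgeSum (fun i A => c i A + c (d i) A) Δ = 0 := by
  have hre : ∑ Δ ∈ Finset.univ.filter (fun Δ : Finset V => Δ.card = D.card ∧ Δ.image rep = D),
      wedgeSum (fun i A => c i A + c (d i) A) Δ =
      ∑ A ∈ Finset.univ.filter (fun A : Finset V => A.card + 1 = D.card),
        ∑ i ∈ Finset.univ.filter (fun i => rep i ∈ D ∧ A.image rep = D.erase (rep i)),
          (c i A + c (d i) A) := by
    unfold wedgeSum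
    rw [Finset.sum_sigma', Finset.sum_sigma']
    refine Finset.sum_nbij' (fun p => ⟨p.1.erase p.2, p.2⟩) (fun p => ⟨insert p.2 p.1, p.2⟩)
      ?_ ?_ ?_ ?_ ?_
    · rintro ⟨Δ, i⟩ h
      simp only [Finset.mem_sigma, Finset.mem_filter, Finset.mem_univ, true_and] at h ⊢
      obtain ⟨⟨h1, h2⟩, h3⟩ := h
      have hcard : (Δ.erase i).card + 1 = D.card := by
        rw [Finset.card_erase_add_one h3, h1]
      have himg : insert (rep i) ((Δ.erase i).image rep) = D := by
        rw [← Finset.image_insert, Finset.insert_erase h3, h2]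
      refine ⟨hcard, himg ▸ Finset.mem_insert_self _ _, ?_⟩
      have hnot : rep i ∉ (Δ.erase i).image rep := by
        intro hmem
        rw [Finset.insert_eq_of_mem hmem] at himg
        have : D.card ≤ (Δ.erase i).card := by
          rw [← himg]
          exact Finset.card_image_le
        omega
      rw [← himg, Finset.erase_insert hnot]
    · rintro ⟨A, i⟩ h
      simp only [Finset.mem_sigma, Finset.mem_filter, Finset.mem_univ, true_and] at h ⊢
      obtain ⟨h1, h2, h3⟩ := h
      have hi : i ∉ A := by
        intro hmem
        have := Finset.mem_image_of_mem rep hmem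
        rw [h3] at this
        exact Finset.notMem_erase _ _ this
      refine ⟨⟨by rw [Finset.card_insert_of_notMem hi, h1], ?_⟩, Finset.mem_insert_self _ _⟩
      rw [Finset.image_insert, h3, Finset.insert_erase h2]
    · rintro ⟨Δ, i⟩ h
      simp only [Finset.mem_sigma, Finset.mem_filter, Finset.mem_univ, true_and] at h
      simp [Finset.insert_erase h.2]
    · rintro ⟨A, i⟩ h
      simp only [Finset.mem_sigma, Finset.mem_filter, Finset.mem_univ, true_and] at h
      obtain ⟨h1, h2, h3⟩ := h
      have hi : i ∉ A := by
        intro hmem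
        have := Finset.mem_image_of_mem rep hmem
        rw [h3] at this
        exact Finset.notMem_erase _ _ this
      simp [Finset.erase_insert hi]
    · rintro ⟨Δ, i⟩ _
      rfl
  rw [hre]
  refine Finset.sum_eq_zero fun A _ => ?_
  rw [Finset.sum_add_distrib, CharTwo.add_eq_zero]
  refine (Finset.sum_equiv d ?_ fun i _ => rfl).symm
  intro i
  simp only [Finset.mem_filter, Finset.mem_univ, true_and, hrep]

/-- A set of representatives avoiding `r` is the only member of its fiber that is not covered by
`hy`, so the fiber relation kills it. A set containing `r` is the only term with `r` in the boundary
relation at `Δ.erase r`. -/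
theorem eq_zero_of_bdry_of_fiber {n : ℕ} {rep : V → V} {r : V} (hr : rep r = r)
    {y : Finset V → ZMod 2} (hb : ∀ A, bdry y A = 0)
    (hfib : ∀ D : Finset V, ∑ Δ ∈ Finset.univ.filter
      (fun Δ : Finset V => Δ.card = D.card ∧ Δ.image rep = D), y Δ = 0)
    (hy : ∀ Δ : Finset V, Δ.card = n → r ∉ Δ → (¬ ∀ x ∈ Δ, rep x = x) → y Δ = 0)
    (Δ : Finset V) (hΔ : Δ.card = n) : y Δ = 0 := by
  have h1 : ∀ Δ : Finset V, Δ.card = n → r ∉ Δ → y Δ = 0 := by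
    intro Δ hΔ hrΔ
    by_cases hreps : ∀ x ∈ Δ, rep x = x
    · have himg : ∀ Δ : Finset V, (∀ x ∈ Δ, rep x = x) → Δ.image rep = Δ := by
        intro Δ h
        rw [Finset.image_congr (g := id) fun x hx => h x hx, Finset.image_id]
      have h := hfib Δ
      rw [Finset.sum_eq_single Δ] at h
      · exact h
      · intro Δ' hmem hne
        obtain ⟨hc, him⟩ := (Finset.mem_filter.1 hmem).2
        refine hy Δ' (hc.trans hΔ) ?_ ?_
        · intro hrm
          have := Finset.mem_image_of_mem rep hrm
          rw [him, hr] at this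
          exact hrΔ this
        · intro hall
          exact hne ((himg _ hall).symm.trans him)
      · intro hmem
        exact absurd (Finset.mem_filter.2 ⟨Finset.mem_univ _, rfl, himg _ hreps⟩) hmem
    · exact hy Δ hΔ hrΔ hreps
  by_cases hrΔ : r ∈ Δ
  · have h := hb (Δ.erase r)
    rw [bdry, Finset.sum_eq_single r] at h
    · rwa [Finset.insert_erase hrΔ] at h
    · intro j hj hjr
      have hj' : j ∉ Δ.erase r := Finset.mem_compl.1 hj
      refine h1 _ ?_ ?_
      · rw [Finset.card_insert_of_notMem hj', Finset.card_erase_add_one hrΔ, hΔ]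
      · rw [Finset.mem_insert, not_or]
        exact ⟨fun e => hjr e.symm, Finset.notMem_erase _ _⟩
    · intro h'
      exact absurd (Finset.mem_compl.2 (Finset.notMem_erase _ _)) h'
  · exact h1 Δ hΔ hrΔ

theorem broadcast_sub (d : Equiv.Perm V) (x x' : V → Finset V → ZMod 2) (Δ : Finset V) :
    broadcast d (x - x') Δ = broadcast d x Δ - broadcast d x' Δ := by
  simp only [broadcast, wedgeSum, bdry, Pi.sub_apply, Finset.sum_sub_distrib,
    Finset.sum_add_distrib]
  ring

/-- A worker that caches only zeros and receives a zero broadcast has a zero next file. -/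
theorem eq_zero_of_broadcast_eq_zero {n : ℕ} (d : Equiv.Perm V) {rep : V → V}
    (hrep : ∀ x, rep (d x) = rep x) {r : V} (hr : rep r = r) {x : V → Finset V → ZMod 2}
    (hx : ∀ f T, f ∉ T → x f T = 0)
    (hy : ∀ Δ : Finset V, Δ.card = n → r ∉ Δ → (¬ ∀ x ∈ Δ, rep x = x) → broadcast d x Δ = 0)
    {i : V} (hi : ∀ f T, i ∈ T → x f T = 0) {T : Finset V} (hT : T.card = n) :
    x (d i) T = 0 := by
  have hy0 : ∀ Δ : Finset V, Δ.card = n → broadcast d x Δ = 0 := by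
    refine eq_zero_of_bdry_of_fiber hr ?_ ?_ hy
    · refine bdry_wedgeSum ?_ ?_
      · intro A
        rw [Finset.sum_add_distrib, CharTwo.add_eq_zero]
        exact (Equiv.sum_comp d fun i => bdry (x i) A).symm
      · intro i E
        have h1 := bdry_bdry (x i) E
        have h2 := bdry_bdry (x (d i)) E
        unfold bdry at h1 h2 ⊢
        rw [Finset.sum_add_distrib, h1, h2, add_zero]
    · intro D
      exact sum_wedgeSum_fiber d hrep (fun i => bdry (x i)) D
  by_cases hiT : i ∈ T
  · exact hi _ _ hiT
  by_cases hdT : d i ∈ T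
  · have hne : i ≠ d i := fun h => hiT (h ▸ hdT)
    set A := T.erase (d i) with hA
    have hiA : i ∉ A := fun h => hiT (Finset.mem_of_mem_erase h)
    have hc : ∀ f A, i ∈ A → bdry (x f) A = 0 := fun f A h =>
      Finset.sum_eq_zero fun j _ => hi _ _ (Finset.mem_insert_of_mem h)
    have hci : bdry (x i) A = 0 := by
      refine Finset.sum_eq_zero fun j _ => ?_
      by_cases hij : i ∈ insert j A
      · exact hi _ _ hij
      · exact hx _ _ hij
    -- In the coefficient of `y` at `insert i A`, the terms with `k ≠ i` involve only bits cached by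
    -- worker `i`, and so does `∂ x i`; what is left is `∂ x (d i)` at `A`, whose only possible
    -- nonzero term is the bit `T`.
    have h := hy0 (insert i A) (by
      rw [Finset.card_insert_of_notMem hiA, hA, Finset.card_erase_add_one hdT, hT])
    rw [broadcast, wedgeSum, Finset.sum_insert hiA, Finset.erase_insert hiA, hci, zero_add,
      Finset.sum_eq_zero, add_zero] at h
    · rw [bdry, Finset.sum_eq_single (d i)] at h
      · rwa [hA, Finset.insert_erase hdT] at h
      · intro j _ hj
        refine hx _ _ ?_
        rw [Finset.mem_insert, not_or]
        exact ⟨fun e => hj e.symm, Finset.notMem_erase _ _⟩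
      · intro h'
        exact absurd (Finset.mem_compl.2 (Finset.notMem_erase _ _)) h'
    · intro k hk
      have hmem : i ∈ (insert i A).erase k :=
        Finset.mem_erase.2 ⟨fun e => hiA (e ▸ hk), Finset.mem_insert_self _ _⟩
      rw [hc _ _ hmem, hc _ _ hmem, add_zero]
  · exact hx _ _ hdT

end ChainComplex

/-! ### Achievability: the symmetric placement -/

variable {K B : ℕ} {S : ℝ}

/-- A decoder may pick any files consistent with the message and the cache; pairs that never occur
get a dummy value. -/
theorem Placement.canDeliver_of_determines (Z : Placement K B S) {d : Equiv.Perm (Fin K)} {l : ℕ}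
    (enc : Files K B → (Fin l → Bool))
    (h : ∀ i W W', enc W = enc W' → Z.content i W = Z.content i W' → W (d i) = W' (d i)) :
    Z.CanDeliver d l := by
  classical
  refine ⟨enc, fun i => ⟨fun M c => if h : ∃ W, enc W = M ∧ Z.content i W = c then
    h.choose (d i) else fun _ => false, fun W => ?_⟩⟩
  have hex : ∃ W', enc W' = enc W ∧ Z.content i W' = Z.content i W := ⟨W, rfl, rfl⟩
  beta_reduce
  rw [dif_pos hex]
  exact h i _ _ hex.choose_spec.1 hex.choose_spec.2

theorem card_subsets_containing (f : Fin K) {s : ℕ} (hs : 1 ≤ s) :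
    (Finset.univ.filter fun T : Finset (Fin K) => f ∈ T ∧ T.card = s).card =
      (K - 1).choose (s - 1) := by
  have h : ((Finset.univ.erase f).powersetCard (s - 1)).card = (K - 1).choose (s - 1) := by
    rw [Finset.card_powersetCard, Finset.card_erase_of_mem (Finset.mem_univ _), Finset.card_univ,
      Fintype.card_fin]
  rw [← h]
  refine Finset.card_nbij' (fun T => T.erase f) (fun A => insert f A) ?_ ?_ ?_ ?_
  · intro T hT
    simp only [Finset.coe_filter, Finset.mem_univ, true_and, Set.mem_ofPred_eq] at hT
    simp only [Finset.mem_coe, Finset.mem_powersetCard]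
    exact ⟨Finset.erase_subset_erase _ (Finset.subset_univ _), by
      rw [Finset.card_erase_of_mem hT.1, hT.2]⟩
  · intro A hA
    simp only [Finset.mem_coe, Finset.mem_powersetCard] at hA
    have hf : f ∉ A := fun h => Finset.notMem_erase _ _ (hA.1 h)
    simp only [Finset.coe_filter, Finset.mem_univ, true_and, Set.mem_ofPred_eq]
    exact ⟨Finset.mem_insert_self _ _, by
      rw [Finset.card_insert_of_notMem hf, hA.2]; omega⟩
  · intro T hT
    simp only [Finset.coe_filter, Finset.mem_univ, true_and, Set.mem_ofPred_eq] at hT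
    exact Finset.insert_erase hT.1
  · intro A hA
    simp only [Finset.mem_coe, Finset.mem_powersetCard] at hA
    exact Finset.erase_insert fun h => Finset.notMem_erase _ _ (hA.1 h)

/-- A labelling of the bits of file `f` by the `s`-sets of workers that contain `f`. -/
noncomputable def bitLabel (f : Fin K) {s : ℕ} (hs : 1 ≤ s) :
    Fin ((K - 1).choose (s - 1)) ≃ {T : Finset (Fin K) // f ∈ T ∧ T.card = s} :=
  (Fintype.equivFinOfCardEq (by
    rw [← card_subsets_containing f hs, Fintype.card_subtype])).symm

/-- The symmetric placement: every bit is cached by exactly the workers in its label. -/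
noncomputable def symmetricPlacement (K : ℕ) {s : ℕ} (hs : 1 ≤ s) :
    Placement K ((K - 1).choose (s - 1)) (s : ℝ) where
  bits j f := Finset.univ.filter fun b => j ∈ (bitLabel f hs b).1
  processing j := by
    ext b
    simpa using (bitLabel j hs b).2.1
  capacity j := by
    have h1 : ∀ f : Fin K, (Finset.univ.filter fun b => j ∈ (bitLabel f hs b).1).card =
        ∑ T ∈ Finset.univ.filter (fun T : Finset (Fin K) => j ∈ T ∧ T.card = s),
          if f ∈ T then 1 else 0 := by
      intro f
      rw [← Finset.card_filter]
      refine Finset.card_bij (fun b _ => (bitLabel f hs b).1) ?_ ?_ ?_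
      · intro b hb
        simp only [Finset.mem_filter, Finset.mem_univ, true_and] at hb ⊢
        exact ⟨⟨hb, (bitLabel f hs b).2.2⟩, (bitLabel f hs b).2.1⟩
      · intro b _ b' _ h
        exact (bitLabel f hs).injective (Subtype.ext h)
      · intro T hT
        simp only [Finset.mem_filter, Finset.mem_univ, true_and] at hT
        refine ⟨(bitLabel f hs).symm ⟨T, hT.2, hT.1.2⟩, ?_, by simp⟩
        simpa using hT.1.1
    -- Double counting of pairs `(f, T)` with `f, j ∈ T`: there are `(K-1 choose s-1)` sets `T`,
    -- each with `s` files, so the cache is filled exactly.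
    rw [Finset.sum_congr rfl fun f _ => h1 f, Finset.sum_comm]
    have h2 : ∀ T ∈ Finset.univ.filter (fun T : Finset (Fin K) => j ∈ T ∧ T.card = s),
        (∑ f : Fin K, if f ∈ T then 1 else 0) = s := by
      intro T hT
      rw [← Finset.card_filter, Finset.filter_univ_mem]
      exact (Finset.mem_filter.1 hT).2.2
    rw [Finset.sum_congr rfl h2, Finset.sum_const, card_subsets_containing j hs]
    rw [nsmul_eq_mul, mul_comm]
    push_cast
    exact le_rfl

theorem symmetricPlacement_canDeliver {s : ℕ} (hs : 1 ≤ s) (hsK : s ≤ K)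
    (d : Equiv.Perm (Fin K)) :
    (symmetricPlacement K hs).CanDeliver d
      ((K - 1).choose s - (numCycles (fileTransitionGraph d) - 1).choose s) := by
  have hK : NeZero K := ⟨by omega⟩
  obtain ⟨rep, hrep, -, hid, hγ⟩ := exists_cycle_representative d
  set γ := numCycles (fileTransitionGraph d) with hγd
  let r := rep 0
  have hr : rep r = r := hid 0
  let R : Finset (Fin K) := Finset.univ.filter fun x => rep x = x
  -- The coefficients that are sent: `s`-sets avoiding `r` that do not consist of representatives
  -- only. As the code is linear, decodability reduces to the difference of two realizations.
  let I : Finset (Finset (Fin K)) := (Finset.univ.erase r).powersetCard s \ (R.erase r).powersetCard s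
  have hI : Fintype.card I = (K - 1).choose s - (γ - 1).choose s := by
    rw [Fintype.card_coe, Finset.card_sdiff_of_subset, Finset.card_powersetCard,
      Finset.card_powersetCard, Finset.card_erase_of_mem (Finset.mem_univ _), Finset.card_univ,
      Fintype.card_fin, Finset.card_erase_of_mem, hγ]
    · exact Finset.mem_filter.2 ⟨Finset.mem_univ _, hr⟩
    · exact Finset.powersetCard_mono (Finset.erase_subset_erase _ (Finset.subset_univ _))
  let e := (Fintype.equivFinOfCardEq hI).symm
  let val : Files K ((K - 1).choose (s - 1)) → Fin K → Finset (Fin K) → ZMod 2 := fun W f T =>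
    if h : f ∈ T ∧ T.card = s then (if W f ((bitLabel f hs).symm ⟨T, h⟩) then 1 else 0) else 0
  refine Placement.canDeliver_of_determines _ (fun W k => decide (broadcast d (val W) (e k) ≠ 0)) ?_
  intro i W W' henc hcont
  have hzmod : ∀ a b : ZMod 2, (a ≠ 0 ↔ b ≠ 0) → a = b := by decide
  have hx : ∀ T : Finset (Fin K), T.card = s → (val W - val W') (d i) T = 0 := by
    intro T hT
    refine eq_zero_of_broadcast_eq_zero (n := s) d hrep hr ?_ ?_ ?_ hT
    · intro f T hf
      simp [val, hf]
    · intro Δ hΔ hrΔ hnr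
      have hmem : Δ ∈ I := by
        simp only [I, Finset.mem_sdiff, Finset.mem_powersetCard, hΔ, and_true]
        refine ⟨fun x hx => Finset.mem_erase.2 ⟨fun h => hrΔ (h ▸ hx), Finset.mem_univ _⟩, ?_⟩
        intro hsub
        exact hnr fun x hx => (Finset.mem_filter.1 (Finset.mem_of_mem_erase (hsub hx))).2
      have h := congrFun henc (e.symm ⟨Δ, hmem⟩)
      simp only [Equiv.apply_symm_apply, decide_eq_decide] at h
      rw [broadcast_sub, hzmod _ _ h, sub_self]
    · intro f T hiT
      rw [Pi.sub_apply, Pi.sub_apply, sub_eq_zero]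
      simp only [val]
      by_cases h : f ∈ T ∧ T.card = s
      · have hb : (bitLabel f hs).symm ⟨T, h⟩ ∈ (symmetricPlacement K hs).bits i f := by
          simpa [symmetricPlacement] using hiT
        have := congrFun (congrFun hcont f) ⟨_, hb⟩
        simp only [Placement.content] at this
        rw [dif_pos h, dif_pos h, this]
      · rw [dif_neg h, dif_neg h]
  funext b
  have h := hx _ (bitLabel (d i) hs b).2.2
  rw [Pi.sub_apply, Pi.sub_apply, sub_eq_zero] at h
  simp only [val, (bitLabel (d i) hs b).2, Subtype.coe_eta, Equiv.symm_apply_apply, and_self,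
    dite_true] at h
  revert h
  cases W (d i) b <;> cases W' (d i) b <;> simp

end DataShuffling
-- Memory sharing and the optimal loads
namespace DataShuffling
open Function

variable {K B : ℕ} {S : ℝ}

theorem Placement.load_le (Z : Placement K B S) {d : Equiv.Perm (Fin K)} {l : ℕ}
    (h : Z.CanDeliver d l) : Z.load d ≤ (l : ℝ) / B := by
  refine div_le_div_of_nonneg_right ?_ (Nat.cast_nonneg B)
  exact_mod_cast Nat.sInf_le h

theorem Placement.load_nonneg (Z : Placement K B S) (d : Equiv.Perm (Fin K)) : 0 ≤ Z.load d :=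
  div_nonneg (Nat.cast_nonneg _) (Nat.cast_nonneg _)

/-- The concatenation of two placements. -/
def Placement.append {B₁ B₂ : ℕ} {S₁ S₂ : ℝ} (Z₁ : Placement K B₁ S₁) (Z₂ : Placement K B₂ S₂)
    (h : S₁ * B₁ + S₂ * B₂ ≤ S * (B₁ + B₂)) : Placement K (B₁ + B₂) S where
  bits j f := (Z₁.bits j f).map (Fin.castAddEmb B₂) ∪ (Z₂.bits j f).map (Fin.natAddEmb B₁)
  processing j := by
    ext b
    refine Fin.addCases (fun b => ?_) (fun b => ?_) b <;>
      simp [Z₁.processing, Z₂.processing]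
  capacity j := by
    have hle : ∑ f, ((Z₁.bits j f).map (Fin.castAddEmb B₂) ∪
        (Z₂.bits j f).map (Fin.natAddEmb B₁)).card ≤
        ∑ f, (Z₁.bits j f).card + ∑ f, (Z₂.bits j f).card := by
      rw [← Finset.sum_add_distrib]
      refine Finset.sum_le_sum fun f _ => (Finset.card_union_le _ _).trans ?_
      rw [Finset.card_map, Finset.card_map]
    have hle' : ((∑ f, ((Z₁.bits j f).map (Fin.castAddEmb B₂) ∪
        (Z₂.bits j f).map (Fin.natAddEmb B₁)).card : ℕ) : ℝ) ≤
        ((∑ f, (Z₁.bits j f).card : ℕ) : ℝ) + ((∑ f, (Z₂.bits j f).card : ℕ) : ℝ) := by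
      exact_mod_cast hle
    rw [Nat.cast_add B₁ B₂]
    exact hle'.trans ((add_le_add (Z₁.capacity j) (Z₂.capacity j)).trans h)

theorem Placement.append_canDeliver {B₁ B₂ : ℕ} {S₁ S₂ : ℝ} (Z₁ : Placement K B₁ S₁)
    (Z₂ : Placement K B₂ S₂) (h : S₁ * B₁ + S₂ * B₂ ≤ S * (B₁ + B₂)) {d : Equiv.Perm (Fin K)}
    {l₁ l₂ : ℕ} (h₁ : Z₁.CanDeliver d l₁) (h₂ : Z₂.CanDeliver d l₂) :
    (Z₁.append Z₂ h).CanDeliver d (l₁ + l₂) := by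
  obtain ⟨enc₁, hd₁⟩ := h₁
  obtain ⟨enc₂, hd₂⟩ := h₂
  refine Placement.canDeliver_of_determines _ (fun W => Fin.append
    (enc₁ fun f b => W f (Fin.castAdd B₂ b)) (enc₂ fun f b => W f (Fin.natAdd B₁ b))) ?_
  intro i W W' henc hcont
  obtain ⟨dec₁, hd₁⟩ := hd₁ i
  obtain ⟨dec₂, hd₂⟩ := hd₂ i
  have he₁ : (enc₁ fun f b => W f (Fin.castAdd B₂ b)) = enc₁ fun f b => W' f (Fin.castAdd B₂ b) := by
    funext k
    simpa using congrFun henc (Fin.castAdd l₂ k)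
  have he₂ : (enc₂ fun f b => W f (Fin.natAdd B₁ b)) = enc₂ fun f b => W' f (Fin.natAdd B₁ b) := by
    funext k
    simpa using congrFun henc (Fin.natAdd l₁ k)
  have hc₁ : Z₁.content i (fun f b => W f (Fin.castAdd B₂ b)) =
      Z₁.content i fun f b => W' f (Fin.castAdd B₂ b) := by
    funext f b
    exact congrFun (congrFun hcont f) ⟨Fin.castAdd B₂ b.1,
      Finset.mem_union_left _ (Finset.mem_map_of_mem (Fin.castAddEmb B₂) b.2)⟩
  have hc₂ : Z₂.content i (fun f b => W f (Fin.natAdd B₁ b)) =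
      Z₂.content i fun f b => W' f (Fin.natAdd B₁ b) := by
    funext f b
    exact congrFun (congrFun hcont f) ⟨Fin.natAdd B₁ b.1,
      Finset.mem_union_right _ (Finset.mem_map_of_mem (Fin.natAddEmb B₁) b.2)⟩
  have hf₁ := hd₁ fun f b => W f (Fin.castAdd B₂ b)
  have hf₂ := hd₂ fun f b => W f (Fin.natAdd B₁ b)
  rw [he₁, hc₁, hd₁] at hf₁
  rw [he₂, hc₂, hd₂] at hf₂
  funext b
  refine Fin.addCases (fun b => ?_) (fun b => ?_) b
  · exact (congrFun hf₁ b).symm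
  · exact (congrFun hf₂ b).symm

/-- Repetition keeps the cache size and the load bound in units of files, while it adjusts the
number of bits. Stating `B'` with an equation avoids casts between placement types. -/
theorem Placement.exists_replicate (Z : Placement K B S) (n : ℕ) :
    ∃ B' : ℕ, B' = n * B ∧ ∃ Z' : Placement K B' S, ∀ d l, Z.CanDeliver d l →
      Z'.CanDeliver d (n * l) := by
  induction n with
  | zero =>
    refine ⟨0, by simp, ⟨fun _ _ => Finset.univ, fun _ => rfl, fun _ => by simp⟩, ?_⟩
    intro d l _
    exact Placement.canDeliver_of_determines _ (fun _ _ => false)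
      fun i W W' _ _ => funext fun b => b.elim0
  | succ n ih =>
    obtain ⟨B', hB', Z', hZ'⟩ := ih
    refine ⟨B' + B, by rw [hB', Nat.succ_mul], Z'.append Z (by rw [mul_add]), ?_⟩
    intro d l h
    rw [Nat.succ_mul]
    exact Placement.append_canDeliver _ _ _ (hZ' d l h) h

theorem natCast_sub_div_eq_cornerLoad {γ s : ℕ} (hγK : γ ≤ K) :
    (((K - 1).choose s - (γ - 1).choose s : ℕ) : ℝ) / ((K - 1).choose (s - 1) : ℕ) =
      cornerLoad K γ s := by
  rw [cornerLoad, Nat.cast_sub (Nat.choose_le_choose _ (by omega))]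

theorem cornerLoad_le (K γ s : ℕ) :
    cornerLoad K γ s ≤ ((K - 1).choose s : ℝ) / ((K - 1).choose (s - 1) : ℝ) := by
  unfold cornerLoad
  refine div_le_div_of_nonneg_right ?_ (Nat.cast_nonneg _)
  exact sub_le_self _ (Nat.cast_nonneg _)

theorem cornerLoad_of_lt {γ s : ℕ} (h : γ - 1 < s) :
    cornerLoad K γ s = ((K - 1).choose s : ℝ) / ((K - 1).choose (s - 1) : ℝ) := by
  simp [cornerLoad, Nat.choose_eq_zero_of_lt h]

theorem symmetricPlacement_load_le {s : ℕ} (hs : 1 ≤ s) (hsK : s ≤ K) (d : Equiv.Perm (Fin K)) :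
    (symmetricPlacement K hs).load d ≤ cornerLoad K (numCycles (fileTransitionGraph d)) s := by
  rw [← natCast_sub_div_eq_cornerLoad (numCycles_le d)]
  exact Placement.load_le _ (symmetricPlacement_canDeliver hs hsK d)

/-- No load in the class exceeds the corner value, while their average is at least that value; hence
none is smaller. -/
theorem symmetricPlacement_load {s : ℕ} (hs : 1 ≤ s) (hsK : s ≤ K) (d : Equiv.Perm (Fin K)) :
    (symmetricPlacement K hs).load d = cornerLoad K (numCycles (fileTransitionGraph d)) s := by
  have : NeZero K := ⟨by omega⟩
  refine le_antisymm (symmetricPlacement_load_le hs hsK d) ?_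
  by_contra! hlt
  have h := (symmetricPlacement K hs).avgLoad_ge (by omega) (Nat.choose_pos (by omega))
    (by exact_mod_cast hsK) d
  have hA : (0 : ℝ) < (assignments (fileTransitionGraph d)).card := by
    exact_mod_cast Finset.card_pos.2 ⟨d, self_mem_assignments d⟩
  rw [lowerConvexEnvelope_natCast (numCycles_pos d) (numCycles_le d) hs hsK, Placement.avgLoad,
    le_div_iff₀ hA] at h
  have hsum : ∑ d' ∈ assignments (fileTransitionGraph d), (symmetricPlacement K hs).load d' <
      ∑ _d' ∈ assignments (fileTransitionGraph d),
        cornerLoad K (numCycles (fileTransitionGraph d)) s := by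
    refine Finset.sum_lt_sum (fun d' hd' => ?_) ⟨d, self_mem_assignments d, hlt⟩
    rw [← numCycles_eq_of_mem_assignments hd']
    exact symmetricPlacement_load_le hs hsK d'
  rw [Finset.sum_const, nsmul_eq_mul] at hsum
  linarith

theorem exists_placement_between {s : ℕ} (hs : 1 ≤ s) (hsK : s < K) (h1 : (s : ℝ) ≤ S)
    (h2 : S ≤ s + 1) {ε : ℝ} (hε : 0 < ε) :
    ∃ B : ℕ, 0 < B ∧ ∃ Z : Placement K B S, ∀ d : Equiv.Perm (Fin K),
      Z.load d ≤ (s + 1 - S) * cornerLoad K (numCycles (fileTransitionGraph d)) s +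
        (S - s) * cornerLoad K (numCycles (fileTransitionGraph d)) (s + 1) + ε := by
  have : NeZero K := ⟨by omega⟩
  set M : ℝ := ((K - 1).choose s : ℝ) / ((K - 1).choose (s - 1) : ℝ) with hM
  have hM0 : 0 ≤ M := by positivity
  -- The files are cut into `N` blocks of `b₁ * b₂` bits, a common multiple of both symmetric file
  -- lengths. `M` bounds the load at `s` for every `γ`, so one `N` serves all assignments.
  obtain ⟨N, hN⟩ := exists_nat_gt (M / ε)
  have hN0 : (0 : ℝ) < N := lt_of_le_of_lt (by positivity) hN
  have hMN : M / N ≤ ε := by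
    rw [div_lt_iff₀ hε] at hN
    rw [div_le_iff₀ hN0]
    linarith
  -- Rounding up gives more blocks to the smaller cache size, which respects the capacity; it costs
  -- less than one block, that is at most `M / N ≤ ε`.
  set m := ⌈(s + 1 - S) * N⌉₊ with hm
  have hm1 : (s + 1 - S) * N ≤ m := Nat.le_ceil _
  have hm2 : (m : ℝ) < (s + 1 - S) * N + 1 :=
    Nat.ceil_lt_add_one (mul_nonneg (by linarith) hN0.le)
  have hmN : m ≤ N := by
    rw [hm, Nat.ceil_le]
    nlinarith
  set b₁ := (K - 1).choose (s - 1) with hb₁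
  set b₂ := (K - 1).choose s with hb₂
  have hb₁0 : 0 < b₁ := Nat.choose_pos (by omega)
  have hb₂0 : 0 < b₂ := Nat.choose_pos (by omega)
  obtain ⟨B₁, hB₁, Z₁, hZ₁⟩ := (symmetricPlacement K hs).exists_replicate (m * b₂)
  obtain ⟨B₂, hB₂, Z₂, hZ₂⟩ :=
    (symmetricPlacement K (Nat.le_add_left 1 s)).exists_replicate ((N - m) * b₁)
  rw [Nat.add_sub_cancel, ← hb₂] at hB₂
  rw [← hb₁] at hB₁
  have hB₁' : (B₁ : ℝ) = m * (b₁ * b₂) := by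
    rw [hB₁]; push_cast; ring
  have hB₂' : (B₂ : ℝ) = (N - m) * (b₁ * b₂) := by
    rw [hB₂, Nat.cast_mul, Nat.cast_mul, Nat.cast_sub hmN]; ring
  have hbb : (0 : ℝ) < b₁ * b₂ := by positivity
  have hcap : (s : ℝ) * B₁ + ((s + 1 : ℕ) : ℝ) * B₂ ≤ S * (B₁ + B₂) := by
    rw [hB₁', hB₂']
    push_cast
    have : (s * m + (s + 1) * (N - m) : ℝ) ≤ S * N := by linarith
    nlinarith [mul_le_mul_of_nonneg_right this hbb.le]
  have hBpos : (0 : ℝ) < (B₁ + B₂ : ℕ) := by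
    push_cast
    rw [hB₁', hB₂', ← add_mul]
    have : (0 : ℝ) < m + (N - m) := by linarith
    positivity
  refine ⟨B₁ + B₂, by exact_mod_cast hBpos, Z₁.append Z₂ hcap, fun d => ?_⟩
  set γ := numCycles (fileTransitionGraph d) with hγ
  have hγ1 : 1 ≤ γ := numCycles_pos d
  have hγK : γ ≤ K := numCycles_le d
  have hdel := Placement.append_canDeliver Z₁ Z₂ hcap
    (hZ₁ d _ (symmetricPlacement_canDeliver hs hsK.le d))
    (hZ₂ d _ (symmetricPlacement_canDeliver (Nat.le_add_left 1 s) hsK d))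
  refine (Placement.load_le _ hdel).trans ?_
  have e₁ := natCast_sub_div_eq_cornerLoad (s := s) hγK
  have e₂ := natCast_sub_div_eq_cornerLoad (s := s + 1) hγK
  rw [Nat.add_sub_cancel, ← hb₂] at e₂
  rw [← hb₁] at e₁
  rw [div_eq_iff (by positivity)] at e₁ e₂
  have hf2 : 0 ≤ cornerLoad K γ (s + 1) := by
    rw [cornerLoad_eq_cornerSum hγ1 hγK (by omega) hsK]
    exact cornerSum_nonneg _ _ _
  have hf1 : cornerLoad K γ s ≤ M := cornerLoad_le _ _ _
  have hf1' : 0 ≤ cornerLoad K γ s := by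
    rw [cornerLoad_eq_cornerSum hγ1 hγK hs hsK.le]
    exact cornerSum_nonneg _ _ _
  rw [div_le_iff₀ hBpos, Nat.cast_add B₁ B₂, hB₁', hB₂', Nat.cast_add, Nat.cast_mul, Nat.cast_mul,
    Nat.cast_mul, Nat.cast_mul, e₁, e₂, Nat.cast_sub hmN]
  have hεN : cornerLoad K γ s ≤ ε * N := by
    rw [div_le_iff₀ hN0] at hMN
    linarith
  have key : m * cornerLoad K γ s + (N - m) * cornerLoad K γ (s + 1) ≤
      ((s + 1 - S) * cornerLoad K γ s + (S - s) * cornerLoad K γ (s + 1) + ε) * N := by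
    nlinarith [mul_le_mul_of_nonneg_right hm2.le hf1', mul_le_mul_of_nonneg_right hm1 hf2]
  have := mul_le_mul_of_nonneg_right key hbb.le
  nlinarith

theorem exists_placement_near_envelope (h1 : 1 ≤ S) (h2 : S ≤ K) {ε : ℝ} (hε : 0 < ε) :
    ∃ B : ℕ, 0 < B ∧ ∃ Z : Placement K B S, ∀ d : Equiv.Perm (Fin K),
      Z.load d ≤ lowerConvexEnvelope
        (cornerPoints K (numCycles (fileTransitionGraph d))) S + ε := by
  have hK : 0 < K := by
    have : (0 : ℝ) < K := by linarith
    exact_mod_cast this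
  have : NeZero K := ⟨hK.ne'⟩
  rcases h2.eq_or_lt with rfl | hlt
  · refine ⟨_, Nat.choose_pos (by omega), symmetricPlacement K hK, fun d => ?_⟩
    rw [lowerConvexEnvelope_natCast (numCycles_pos d) (numCycles_le d) hK le_rfl]
    linarith [symmetricPlacement_load_le hK le_rfl d]
  · set s := ⌊S⌋₊ with hs
    have hs1 : 1 ≤ s := Nat.le_floor (by simpa using h1)
    have hsS : (s : ℝ) ≤ S := Nat.floor_le (by linarith)
    have hSs : S ≤ s + 1 := (Nat.lt_floor_add_one S).le
    have hsK : s < K := by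
      have : (s : ℝ) < K := by linarith
      exact_mod_cast this
    obtain ⟨B, hB, Z, hZ⟩ := exists_placement_between hs1 hsK hsS hSs hε
    refine ⟨B, hB, Z, fun d => (hZ d).trans ?_⟩
    have hγ1 := numCycles_pos d
    have hγK := numCycles_le d
    -- This support line touches at both `K - (s+1)` and `K - s`, so at `S` it equals the
    -- interpolation of the two neighbouring corners.
    have h := le_lowerConvexEnvelope hγ1 hγK h1 h2 (K - (s + 1))
    rw [cornerLoad_eq_cornerSum hγ1 hγK hs1 hsK.le,
      cornerLoad_eq_cornerSum hγ1 hγK (by omega) hsK,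
      show K - s = K - (s + 1) + 1 by omega, cornerSum_succ]
    rw [Nat.cast_sub hsK] at h
    push_cast at h
    linarith

theorem Placement.avgLoad_le {c : ℝ} (Z : Placement K B S) (d : Equiv.Perm (Fin K))
    (h : ∀ d' ∈ assignments (fileTransitionGraph d), Z.load d' ≤ c) :
    Z.avgLoad (fileTransitionGraph d) ≤ c := by
  have hA : (0 : ℝ) < (assignments (fileTransitionGraph d)).card := by
    exact_mod_cast Finset.card_pos.2 ⟨d, self_mem_assignments d⟩
  rw [Placement.avgLoad, div_le_iff₀ hA, mul_comm, ← nsmul_eq_mul]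
  exact Finset.sum_le_card_nsmul _ _ _ h

theorem optLoad_eq_lowerConvexEnvelope (h1 : 1 ≤ S) (h2 : S ≤ K) (d : Equiv.Perm (Fin K)) :
    optLoad S (fileTransitionGraph d) =
      lowerConvexEnvelope (cornerPoints K (numCycles (fileTransitionGraph d))) S := by
  have hK : 0 < K := by
    have : (0 : ℝ) < K := by linarith
    exact_mod_cast this
  have hlb : ∀ r ∈ {r : ℝ | ∃ B : ℕ, 0 < B ∧ ∃ Z : Placement K B S,
      r = Z.avgLoad (fileTransitionGraph d)},
      lowerConvexEnvelope (cornerPoints K (numCycles (fileTransitionGraph d))) S ≤ r := by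
    rintro r ⟨B, hB, Z, rfl⟩
    exact Z.avgLoad_ge hK hB h2 d
  apply le_antisymm
  · refine le_of_forall_pos_le_add fun ε hε => ?_
    obtain ⟨B, hB, Z, hZ⟩ := exists_placement_near_envelope (K := K) h1 h2 hε
    refine (csInf_le ⟨_, hlb⟩ ⟨B, hB, Z, rfl⟩).trans (Z.avgLoad_le d fun d' hd' => ?_)
    rw [← numCycles_eq_of_mem_assignments hd']
    exact hZ d'
  · obtain ⟨B, hB, Z, -⟩ := exists_placement_near_envelope (K := K) h1 h2 one_pos
    exact le_csInf ⟨_, B, hB, Z, rfl⟩ hlb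

theorem optLoad_natCast {s : ℕ} (h1 : 1 ≤ s) (h2 : s ≤ K) (d : Equiv.Perm (Fin K)) :
    optLoad (s : ℝ) (fileTransitionGraph d) =
      cornerLoad K (numCycles (fileTransitionGraph d)) s := by
  have : NeZero K := ⟨by omega⟩
  rw [optLoad_eq_lowerConvexEnvelope (by exact_mod_cast h1) (by exact_mod_cast h2),
    lowerConvexEnvelope_natCast (numCycles_pos d) (numCycles_le d) h1 h2]

theorem Placement.avgLoad_le_maxLoad (Z : Placement K B S) (d : Equiv.Perm (Fin K)) :
    Z.avgLoad (fileTransitionGraph d) ≤ Z.maxLoad :=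
  Z.avgLoad_le d fun d' _ => le_ciSup (Set.finite_range _).bddAbove d'

theorem optWorstLoad_natCast {s : ℕ} (h1 : 1 ≤ s) (h2 : s ≤ K) :
    optWorstLoad K (s : ℝ) = ((K - 1).choose s : ℝ) / ((K - 1).choose (s - 1) : ℝ) := by
  obtain ⟨d, hd⟩ := exists_numCycles_eq_one (K := K) (by omega)
  have hB : 0 < (K - 1).choose (s - 1) := Nat.choose_pos (by omega)
  have hlb : ∀ r ∈ {r : ℝ | ∃ B : ℕ, 0 < B ∧ ∃ Z : Placement K B (s : ℝ), r = Z.maxLoad},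
      ((K - 1).choose s : ℝ) / ((K - 1).choose (s - 1) : ℝ) ≤ r := by
    rintro r ⟨B, hB, Z, rfl⟩
    -- The assignments with a single cycle are already worst: `γ - 1 = 0` removes the subtracted
    -- binomial.
    refine le_trans ?_ (Z.avgLoad_le_maxLoad d)
    rw [← cornerLoad_of_lt (γ := 1) (by omega), ← hd, ← optLoad_natCast h1 h2]
    refine csInf_le ⟨0, ?_⟩ ⟨B, hB, Z, rfl⟩
    rintro r ⟨B, hB, Z, rfl⟩
    exact div_nonneg (Finset.sum_nonneg fun _ _ => Z.load_nonneg _) (Nat.cast_nonneg _)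
  apply le_antisymm
  · refine (csInf_le ⟨_, hlb⟩ ⟨_, hB, symmetricPlacement K h1, rfl⟩).trans ?_
    exact ciSup_le fun d => (symmetricPlacement_load_le h1 h2 d).trans (cornerLoad_le _ _ _)
  · exact le_csInf ⟨_, _, hB, symmetricPlacement K h1, rfl⟩ hlb

end DataShuffling

theorem corollary1 (K : ℕ) :
    -- integer cache size: the optimal load for every file transition graph
    (∀ S : ℕ, 1 ≤ S → S ≤ K → ∀ d : Equiv.Perm (Fin K),
      DataShuffling.optLoad (S : ℝ) (DataShuffling.fileTransitionGraph d) =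
        DataShuffling.cornerLoad K
          (DataShuffling.numCycles (DataShuffling.fileTransitionGraph d)) S) ∧
    -- integer cache size: one placement has the optimal load for all assignments simultaneously
    (∀ S : ℕ, 1 ≤ S → S ≤ K →
      ∃ B : ℕ, 0 < B ∧ ∃ Z : DataShuffling.Placement K B (S : ℝ),
        ∀ d : Equiv.Perm (Fin K),
          Z.load d = DataShuffling.cornerLoad K
            (DataShuffling.numCycles (DataShuffling.fileTransitionGraph d)) S) ∧
    -- arbitrary real cache size: the lower convex envelope of the corner points
    (∀ S : ℝ, 1 ≤ S → S ≤ K → ∀ d : Equiv.Perm (Fin K),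
      DataShuffling.optLoad S (DataShuffling.fileTransitionGraph d) =
        DataShuffling.lowerConvexEnvelope
          (DataShuffling.cornerPoints K
            (DataShuffling.numCycles (DataShuffling.fileTransitionGraph d))) S) ∧
    -- arbitrary real cache size: the optimum is approached by placements that serve all assignments
    (∀ S : ℝ, 1 ≤ S → S ≤ K → ∀ ε : ℝ, 0 < ε →
      ∃ B : ℕ, 0 < B ∧ ∃ Z : DataShuffling.Placement K B S,
        ∀ d : Equiv.Perm (Fin K),
          Z.load d ≤ DataShuffling.lowerConvexEnvelope
            (DataShuffling.cornerPoints K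
              (DataShuffling.numCycles (DataShuffling.fileTransitionGraph d))) S + ε) ∧
    -- the worst case over all shufflings, attained whenever `γ - 1 < S`
    (∀ S : ℕ, 1 ≤ S → S ≤ K →
      (∀ d : Equiv.Perm (Fin K),
        DataShuffling.numCycles (DataShuffling.fileTransitionGraph d) - 1 < S →
          DataShuffling.optLoad (S : ℝ) (DataShuffling.fileTransitionGraph d) =
            ((K - 1).choose S : ℝ) / ((K - 1).choose (S - 1) : ℝ)) ∧
      IsGreatest
        (Set.range fun d : Equiv.Perm (Fin K) =>
          DataShuffling.optLoad (S : ℝ) (DataShuffling.fileTransitionGraph d))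
        (((K - 1).choose S : ℝ) / ((K - 1).choose (S - 1) : ℝ)) ∧
      DataShuffling.optWorstLoad K (S : ℝ) =
        ((K - 1).choose S : ℝ) / ((K - 1).choose (S - 1) : ℝ)) := by
  refine ⟨fun S h1 h2 d => DataShuffling.optLoad_natCast h1 h2 d, fun S h1 h2 => ?_,
    fun S h1 h2 d => DataShuffling.optLoad_eq_lowerConvexEnvelope h1 h2 d,
    fun S h1 h2 ε hε => DataShuffling.exists_placement_near_envelope h1 h2 hε,
    fun S h1 h2 => ⟨fun d hd => ?_, ⟨?_, ?_⟩, DataShuffling.optWorstLoad_natCast h1 h2⟩⟩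
  · exact ⟨_, Nat.choose_pos (by omega), DataShuffling.symmetricPlacement K h1,
      DataShuffling.symmetricPlacement_load h1 h2⟩
  · rw [DataShuffling.optLoad_natCast h1 h2, DataShuffling.cornerLoad_of_lt hd]
  · obtain ⟨d, hd⟩ := DataShuffling.exists_numCycles_eq_one (K := K) (by omega)
    refine ⟨d, ?_⟩
    change DataShuffling.optLoad _ _ = _
    rw [DataShuffling.optLoad_natCast h1 h2, hd, DataShuffling.cornerLoad_of_lt (by omega)]
  · rintro _ ⟨d, rfl⟩
    change DataShuffling.optLoad _ _ ≤ _
    rw [DataShuffling.optLoad_natCast h1 h2]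
    exact DataShuffling.cornerLoad_le _ _ _
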